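/- Let $H$ be a real separable Hilbert space (of finite or infinite dimension). Let $A:D(A)\subset H\to H$ be the infinitesimal generator of a strongly continuous semigroup $(e^{tA})_{t\ge 0}$ on $H$, and let $Q$ be a nonnegative self-adjoint bounded operator on $H$ with $\ker Q=\{0\}$. For $t\ge 0$ put $Q_t x=\int_0^t e^{sA}Qe^{sA^*}x\,ds$ $(x\in H)$. Assume that, for every $t>0$, the operator $Q_t$ is of trace class and $e^{tA}(H)\subset Q_t^{1/2}(H)$, and that there are $\delta\in(0,1)$ and $C_\delta>0$ such that the operators $\Lambda(t)=Q_t^{-1/2}e^{tA}$ satisfy $\|\Lambda(t)\|_{\mathcal L(H)}\le C_\delta t^{-\delta}$ for all $t>0$. Let $u_0:H\to\mathbb R$ and $B:H\to H$ be bounded and (Borel) measurable. Let $N_{Q_t}$ be the centred Gaussian measure on $H$ with covariance operator $Q_t$, and for bounded measurable $f:H\to\mathbb R$ let $(S_tf)(x)=\int_H f(e^{tA}x+y)\,N_{Q_t}(dy)$; equivalently $(S_tf)(x)=\mathbb E f(Z^x_t)$, where $Z^x$ is the solution of $dZ_t=AZ_t\,dt+\sqrt Q\,dW_t$, $Z_0=x$,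 with $W$ a cylindrical Brownian motion on $H$. Define, for $t>0$ and $x\in H$, $$v^0(t,x)=(S_tu_0)(x),\qquad k^n_s(y)=\langle B(y),Dv^n(s,y)\rangle,\qquad v^{n+1}(t,x)=\int_0^t (S_{t-s}k^n_s)(x)\,ds\qquad(n\ge 0),$$ where $D$ is the Fréchet derivative in the space variable. Then this iteration is well defined: for all $n\ge0$ and $t>0$, the function $v^n(t)=v^n(t,\cdot)$ is bounded and Fréchet differentiable on $H$ with bounded derivative, $k^n_t$ is bounded and measurable, and $s\mapsto (S_{t-s}k^n_s)(x)$ is integrable on $(0,t)$ for every $x\in H$. Moreover, for all $n\ge 0$ and $t>0$, $$\|v^n(t)\|_\infty\le \|u_0\|_\infty\,\|B\|_\infty^n\,C_\delta^n\,t^{n(1-\delta)}\,\frac{\Gamma(1-\delta)^n}{\Gamma(1+n(1-\delta))}$$ and $$\|Dv^n(t)\|_\infty\le \|u_0\|_\infty\,\|B\|_\infty^n\,C_\delta^{n+1}\,t^{n(1-\delta)-\delta}\,\frac{\Gamma(1-\delta)^{n+1}}{\Gamma((n+1)(1-\delta))},$$ where $\|\cdot\|_\infty$ is the supremum norm over $H$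 and $\Gamma$ is the Gamma function. In particular the bounds do not depend on the dimension of $H$. -/

import Mathlib

open MeasureTheory ProbabilityTheory Filter Topology Set
open scoped RealInnerProductSpace

namespace Kolmogorov

/-! ### Strongly continuous semigroups -/

/-- A strongly continuous semigroup `(e^{tA})_{t ≥ 0}` of bounded operators on `H`
(the values at negative times are irrelevant). -/
structure C0Semigroup (H : Type*) [NormedAddCommGroup H] [NormedSpace ℝ H] where
  /-- the operator `e^{tA}` -/
  op : ℝ → H →L[ℝ] H
  op_zero : op 0 = ContinuousLinearMap.id ℝ H
  op_add : ∀ s t : ℝ, 0 ≤ s → 0 ≤ t → op (s + t) = (op s).comp (op t)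
  continuousOn : ∀ x : H, ContinuousOn (fun t => op t x) (Ici 0)

/-- The (in general unbounded) operator `A`, with its domain, is the infinitesimal generator of
the semigroup `T`: the domain of `A` is the set of all `x` for which `(T t x - x) / t` converges
as `t ↓ 0`, and `A x` is the limit. -/
def IsGenerator {H : Type*} [NormedAddCommGroup H] [NormedSpace ℝ H]
    (A : H →ₗ.[ℝ] H) (T : C0Semigroup H) : Prop :=
  (∀ x : H, x ∈ A.domain ↔
    ∃ y : H, Tendsto (fun t : ℝ => t⁻¹ • (T.op t x - x)) (𝓝[>] 0) (𝓝 y)) ∧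
  ∀ x : A.domain, Tendsto (fun t : ℝ => t⁻¹ • (T.op t (x : H) - (x : H))) (𝓝[>] 0) (𝓝 (A x))

section Hilbert

variable {H : Type*} [NormedAddCommGroup H] [InnerProductSpace ℝ H]

/-! ### Measurability and boundedness facts needed for the operator `Q_t` -/

/-- In a separable Hilbert space weakly measurable functions are strongly measurable. -/
theorem stronglyMeasurable_of_inner [CompleteSpace H] [SecondCountableTopology H]
    {α : Type*} [MeasurableSpace α] {f : α → H}
    (hf : ∀ y : H, Measurable fun a => ⟪y, f a⟫) : StronglyMeasurable f := by
  let U : ℕ → Submodule ℝ H := fun n =>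
    Submodule.span ℝ ((TopologicalSpace.denseSeq H) '' (Finset.range n : Set ℕ))
  have hfin : ∀ n, FiniteDimensional ℝ (U n) := fun n =>
    FiniteDimensional.span_of_finite ℝ ((Finset.finite_toSet _).image _)
  have hmono : Monotone U := fun m n h => Submodule.span_mono
    (image_mono (by simpa using h))
  have hdense : ⊤ ≤ (⨆ n, U n).topologicalClosure := by
    intro x _
    have hx : x ∈ closure (range (TopologicalSpace.denseSeq H)) :=
      TopologicalSpace.denseRange_denseSeq H x
    refine closure_mono ?_ hx
    rintro _ ⟨n, rfl⟩
    exact Submodule.mem_iSup_of_mem (n + 1)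
      (Submodule.subset_span ⟨n, by simp, rfl⟩)
  have key : ∀ n, StronglyMeasurable fun a => (U n).starProjection (f a) := by
    intro n
    have : (fun a => (U n).starProjection (f a)) = fun a =>
        ∑ i, ⟪((stdOrthonormalBasis ℝ (U n) i : U n) : H), f a⟫ •
          ((stdOrthonormalBasis ℝ (U n) i : U n) : H) := by
      funext a
      have := (stdOrthonormalBasis ℝ (U n)).orthogonalProjectionOnto_apply_eq_sum (f a)
      rw [Submodule.starProjection_apply, this]
      simp
    rw [this]
    exact Finset.stronglyMeasurable_fun_sum _ fun i _ =>
      (hf _).stronglyMeasurable.smul_const _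
  refine stronglyMeasurable_of_tendsto atTop key ?_
  rw [tendsto_pi_nhds]
  exact fun a => Submodule.starProjection_tendsto_self U hmono (f a) hdense

/-- A strongly continuous semigroup is bounded on compact time intervals. -/
theorem C0Semigroup.exists_bound [CompleteSpace H] (T : C0Semigroup H) (t : ℝ) :
    ∃ M : ℝ, 0 ≤ M ∧ ∀ s ∈ Ioc 0 t, ‖T.op s‖ ≤ M := by
  obtain ⟨M, hM⟩ := banach_steinhaus (g := fun s : Icc (0 : ℝ) t => T.op s) (by
    intro x
    obtain ⟨C, hC⟩ := isCompact_Icc.exists_bound_of_continuousOn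
      ((T.continuousOn x).mono (Icc_subset_Ici_self : Icc 0 t ⊆ Ici 0))
    exact ⟨C, fun s => hC s s.2⟩)
  exact ⟨max M 0, le_max_right _ _, fun s hs =>
    (hM ⟨s, hs.1.le, hs.2⟩).trans (le_max_left _ _)⟩

variable [CompleteSpace H]

/-- The integrand `s ↦ e^{sA} Q e^{sA*} x`. -/
noncomputable def covIntegrand (T : C0Semigroup H) (Q : H →L[ℝ] H) (x : H) (s : ℝ) : H :=
  T.op s (Q (ContinuousLinearMap.adjoint (T.op s) x))

theorem norm_covIntegrand_le (T : C0Semigroup H) (Q : H →L[ℝ] H) {M s : ℝ} (hM : 0 ≤ M)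
    (hs : ‖T.op s‖ ≤ M) (x : H) : ‖covIntegrand T Q x s‖ ≤ M * (‖Q‖ * M) * ‖x‖ := by
  have h1 : ‖ContinuousLinearMap.adjoint (T.op s) x‖ ≤ M * ‖x‖ :=
    ContinuousLinearMap.le_of_opNorm_le _ (by simpa using hs) x
  calc ‖covIntegrand T Q x s‖ ≤ M * ‖Q (ContinuousLinearMap.adjoint (T.op s) x)‖ :=
        ContinuousLinearMap.le_of_opNorm_le _ hs _
    _ ≤ M * (‖Q‖ * ‖ContinuousLinearMap.adjoint (T.op s) x‖) := by
        gcongr; exact Q.le_opNorm _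
    _ ≤ M * (‖Q‖ * (M * ‖x‖)) := by gcongr
    _ = M * (‖Q‖ * M) * ‖x‖ := by ring

variable [SecondCountableTopology H]

theorem stronglyMeasurable_adjoint (T : C0Semigroup H) (x : H) :
    StronglyMeasurable fun s : Ioi (0 : ℝ) => ContinuousLinearMap.adjoint (T.op s) x := by
  refine stronglyMeasurable_of_inner fun y => Continuous.measurable ?_
  simp only [ContinuousLinearMap.adjoint_inner_right]
  have h : Continuous fun s : Ioi (0 : ℝ) => T.op s y :=
    continuousOn_iff_continuous_domRestrict.1 ((T.continuousOn y).mono Ioi_subset_Ici_self)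
  exact h.inner continuous_const

theorem integrableOn_covIntegrand (T : C0Semigroup H) (Q : H →L[ℝ] H) (t : ℝ) (x : H) :
    IntegrableOn (covIntegrand T Q x) (Ioc 0 t) := by
  obtain ⟨M, hM0, hM⟩ := T.exists_bound t
  have hmeas : StronglyMeasurable fun s : Ioi (0 : ℝ) => covIntegrand T Q x s := by
    refine stronglyMeasurable_of_inner fun y => ?_
    have : (fun s : Ioi (0 : ℝ) => ⟪y, covIntegrand T Q x s⟫) = fun s : Ioi (0 : ℝ) =>
        ⟪ContinuousLinearMap.adjoint (T.op s) y,
          Q (ContinuousLinearMap.adjoint (T.op s) x)⟫ := by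
      funext s
      rw [ContinuousLinearMap.adjoint_inner_left]
      rfl
    rw [this]
    exact ((stronglyMeasurable_adjoint T y).inner
      (Q.continuous.comp_stronglyMeasurable (stronglyMeasurable_adjoint T x))).measurable
  have hae : AEStronglyMeasurable (covIntegrand T Q x) (volume.restrict (Ioi (0 : ℝ))) := by
    have h2 := hmeas.aestronglyMeasurable (μ := Measure.comap ((↑) : Ioi (0 : ℝ) → ℝ) volume)
    have h3 := (MeasurableEmbedding.subtype_coe (measurableSet_Ioi (a := (0 : ℝ))))
    rw [← map_comap_subtype_coe measurableSet_Ioi]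
    exact h3.aestronglyMeasurable_map_iff.2 h2
  refine IntegrableOn.of_bound (by simp)
    (hae.mono_measure (Measure.restrict_mono_set _ Ioc_subset_Ioi_self))
    (M * (‖Q‖ * M) * ‖x‖) ?_
  exact (ae_restrict_iff' measurableSet_Ioc).2
    (Eventually.of_forall fun s hs => norm_covIntegrand_le T Q hM0 (hM s hs) x)

/-- The operator `Q_t = ∫_0^t e^{sA} Q e^{sA*} ds`, the integral being taken in the strong sense:
`Q_t x = ∫_0^t e^{sA} Q e^{sA*} x ds` for every `x`. -/
noncomputable def covOp (T : C0Semigroup H) (Q : H →L[ℝ] H) (t : ℝ) : H →L[ℝ] H :=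
  LinearMap.mkContinuousOfExistsBound
    { toFun := fun x => ∫ s in Ioc 0 t, T.op s (Q (ContinuousLinearMap.adjoint (T.op s) x))
      map_add' := fun x y => by
        have h := integral_add (integrableOn_covIntegrand T Q t x)
          (integrableOn_covIntegrand T Q t y)
        simpa [covIntegrand] using h
      map_smul' := fun c x => by
        rw [RingHom.id_apply, ← integral_smul]
        simp }
    (by
      obtain ⟨M, hM0, hM⟩ := T.exists_bound t
      refine ⟨M * (‖Q‖ * M) * volume.real (Ioc 0 t), fun x => ?_⟩
      refine (norm_setIntegral_le_of_norm_le_const (C := M * (‖Q‖ * M) * ‖x‖) (by simp)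
        fun s hs => norm_covIntegrand_le T Q hM0 (hM s hs) x).trans (le_of_eq ?_)
      ring)

theorem covOp_apply (T : C0Semigroup H) (Q : H →L[ℝ] H) {t : ℝ} (ht : 0 ≤ t) (x : H) :
    covOp T Q t x = ∫ s in (0 : ℝ)..t, T.op s (Q (ContinuousLinearMap.adjoint (T.op s) x)) :=
  (intervalIntegral.integral_of_le ht).symm

theorem inner_covOp (T : C0Semigroup H) (Q : H →L[ℝ] H) (t : ℝ) (x y : H) :
    ⟪y, covOp T Q t x⟫ = ∫ s in Ioc 0 t, ⟪ContinuousLinearMap.adjoint (T.op s) y,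
      Q (ContinuousLinearMap.adjoint (T.op s) x)⟫ := by
  simp only [ContinuousLinearMap.adjoint_inner_left]
  exact (integral_inner (integrableOn_covIntegrand T Q t x) y).symm

/-- `Q_t` is a nonnegative self-adjoint operator. -/
theorem covOp_isPositive (T : C0Semigroup H) {Q : H →L[ℝ] H} (hQ : Q.IsPositive) (t : ℝ) :
    (covOp T Q t).IsPositive := by
  have hsymm : ∀ x y, ⟪Q x, y⟫ = ⟪x, Q y⟫ := hQ.isSymmetric
  rw [ContinuousLinearMap.isPositive_def]
  constructor
  · intro x y
    show ⟪covOp T Q t x, y⟫ = ⟪x, covOp T Q t y⟫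
    rw [real_inner_comm, inner_covOp, inner_covOp]
    refine integral_congr_ae (Eventually.of_forall fun s => ?_)
    show ⟪ContinuousLinearMap.adjoint (T.op s) y, Q (ContinuousLinearMap.adjoint (T.op s) x)⟫ =
      ⟪ContinuousLinearMap.adjoint (T.op s) x, Q (ContinuousLinearMap.adjoint (T.op s) y)⟫
    rw [real_inner_comm, hsymm]
  · intro x
    rw [ContinuousLinearMap.reApplyInnerSelf_apply, real_inner_comm, inner_covOp]
    exact integral_nonneg fun s => hQ.inner_nonneg_right _

end Hilbert

/-! ### Trace class operators, square roots, and the operator `R⁻¹ S` -/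

section Operators

variable {H : Type*} [NormedAddCommGroup H] [InnerProductSpace ℝ H]

/-- Trace class (nuclear) operators on a separable Hilbert space: `R = ∑ ⟪a_n, ·⟫ b_n` with
`∑ ‖a_n‖ ‖b_n‖ < ∞`. -/
def IsTraceClass (R : H →L[ℝ] H) : Prop :=
  ∃ a b : ℕ → H, Summable (fun n => ‖a n‖ * ‖b n‖) ∧
    ∀ x : H, HasSum (fun n => ⟪a n, x⟫ • b n) (R x)

theorem IsTraceClass.summable_inner {R : H →L[ℝ] H} (hR : R.IsPositive) (h : IsTraceClass R)
    {ι : Type*} (e : HilbertBasis ι ℝ H) : Summable fun i => ⟪R (e i), e i⟫ := by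
  obtain ⟨a, b, hab, hs⟩ := h
  refine summable_of_sum_le (c := ∑' n, ‖a n‖ * ‖b n‖) (fun i => hR.inner_nonneg_left _)
    fun F => ?_
  have h1 : HasSum (fun n => ∑ i ∈ F, ⟪a n, e i⟫ * ⟪b n, e i⟫) (∑ i ∈ F, ⟪R (e i), e i⟫) := by
    refine hasSum_sum fun i _ => ?_
    have h := (hs (e i)).mapL (innerSL ℝ (e i))
    simpa [real_inner_comm, inner_smul_left, inner_smul_right] using h
  refine hasSum_le (fun n => ?_) h1 hab.hasSum
  have h2 : ∀ z : H, ∑ i ∈ F, ⟪z, e i⟫ ^ 2 ≤ ‖z‖ ^ 2 := fun z => by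
    have := e.orthonormal.sum_inner_products_le (x := z) (s := F)
    simpa [real_inner_comm] using this
  have h3 := Finset.sum_mul_sq_le_sq_mul_sq F (fun i => ⟪a n, e i⟫) (fun i => ⟪b n, e i⟫)
  refine le_of_sq_le_sq (h3.trans ?_) (by positivity)
  rw [mul_pow]
  exact mul_le_mul (h2 _) (h2 _) (Finset.sum_nonneg fun _ _ => sq_nonneg _) (sq_nonneg _)

theorem norm_integral_exp_sub_le {Ω : Type*} [MeasurableSpace Ω] (ν : Measure Ω)
    [IsProbabilityMeasure ν] (X Y : Lp H 2 ν) (y : H) :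
    ‖(∫ ω, Complex.exp (⟪X ω, y⟫ * Complex.I) ∂ν) - ∫ ω, Complex.exp (⟪Y ω, y⟫ * Complex.I) ∂ν‖
      ≤ ‖X - Y‖ * ‖y‖ := by
  have hint : ∀ Z : Lp H 2 ν, Integrable (fun ω => Complex.exp (⟪Z ω, y⟫ * Complex.I)) ν := by
    intro Z
    refine Integrable.of_bound (C := 1) ?_ (Eventually.of_forall fun ω => ?_)
    · have h := (Lp.aestronglyMeasurable Z).inner (𝕜 := ℝ)
        (aestronglyMeasurable_const (b := y))
      exact (by fun_prop : Continuous fun r : ℝ =>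
        Complex.exp (r * Complex.I)).comp_aestronglyMeasurable h
    · rw [Complex.norm_exp_ofReal_mul_I]
  have hexp : ∀ r s : ℝ, ‖Complex.exp (r * Complex.I) - Complex.exp (s * Complex.I)‖
      ≤ |r - s| := by
    intro r s
    have h1 : Complex.exp (r * Complex.I) - Complex.exp (s * Complex.I)
        = Complex.exp (s * Complex.I) * (Complex.exp (Complex.I * ((r - s : ℝ) : ℂ)) - 1) := by
      rw [mul_sub, ← Complex.exp_add, mul_one]
      congr 2
      push_cast; ring
    rw [h1, norm_mul, Complex.norm_exp_ofReal_mul_I, one_mul]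
    exact Real.norm_exp_I_mul_ofReal_sub_one_le
  have hXY : MemLp (fun ω => X ω - Y ω) 2 ν := (Lp.memLp X).sub (Lp.memLp Y)
  have hL1 : Integrable (fun ω => ‖X ω - Y ω‖) ν :=
    (hXY.integrable (by norm_num)).norm
  rw [← integral_sub (hint X) (hint Y)]
  calc ‖∫ ω, (Complex.exp (⟪X ω, y⟫ * Complex.I) - Complex.exp (⟪Y ω, y⟫ * Complex.I)) ∂ν‖
      ≤ ∫ ω, ‖X ω - Y ω‖ * ‖y‖ ∂ν := by
        refine norm_integral_le_of_norm_le (hL1.mul_const _)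
          (Eventually.of_forall fun ω => (hexp _ _).trans ?_)
        rw [← inner_sub_left]
        exact abs_real_inner_le_norm _ _
    _ = (∫ ω, ‖X ω - Y ω‖ ∂ν) * ‖y‖ := integral_mul_const _ _
    _ ≤ ‖X - Y‖ * ‖y‖ := by
        gcongr
        have h2 : eLpNorm (fun ω => X ω - Y ω) 1 ν ≤ eLpNorm (fun ω => X ω - Y ω) 2 ν :=
          eLpNorm_le_eLpNorm_of_exponent_le (by norm_num) hXY.1
        have h3 : ‖X - Y‖ = (eLpNorm (fun ω => X ω - Y ω) 2 ν).toReal := by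
          rw [Lp.norm_def]
          congr 1
          exact eLpNorm_congr_ae (Lp.coeFn_sub X Y)
        rw [h3, integral_norm_eq_lintegral_enorm hXY.1, ← eLpNorm_one_eq_lintegral_enorm]
        exact ENNReal.toReal_mono hXY.2.ne h2

variable [CompleteSpace H]

/-- If `K` is self-adjoint with `‖K‖ ≤ 1`, then `1 - K` has a nonnegative square root. -/
theorem exists_sqrt_aux (K : H →L[ℝ] H) (hK : IsSelfAdjoint K) (hK1 : ‖K‖ ≤ 1) :
    ∃ P : H →L[ℝ] H, P.IsPositive ∧ P * P = 1 - K := by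
  obtain ⟨a, a0, aS⟩ : ∃ a : ℕ → ℝ, a 0 = 0 ∧ ∀ n, a (n + 1) = (1 + a n ^ 2) / 2 :=
    ⟨fun n => Nat.rec 0 (fun _ r => (1 + r ^ 2) / 2) n, rfl, fun _ => rfl⟩
  obtain ⟨S, S0, SS⟩ : ∃ S : ℕ → H →L[ℝ] H, S 0 = 0 ∧
      ∀ n, S (n + 1) = (2⁻¹ : ℝ) • (K + S n * S n) :=
    ⟨fun n => Nat.rec 0 (fun _ R => (2⁻¹ : ℝ) • (K + R * R)) n, rfl, fun _ => rfl⟩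
  have ha : ∀ n, 0 ≤ a n ∧ a n ≤ 1 := by
    intro n
    induction n with
    | zero => simp [a0]
    | succ n ih => rw [aS]; constructor <;> nlinarith [ih.1, ih.2]
  have hS : ∀ n, ‖S n‖ ≤ a n := by
    intro n
    induction n with
    | zero => simp [a0, S0]
    | succ n ih =>
      rw [aS, SS, norm_smul]
      have h1 : ‖S n * S n‖ ≤ a n ^ 2 := by
        rw [pow_two]
        exact (norm_mul_le _ _).trans (mul_le_mul ih ih (norm_nonneg _) (ha n).1)
      have h2 := norm_add_le K (S n * S n)
      norm_num
      linarith
  have hstep : ∀ n, ‖S (n + 1) - S n‖ ≤ a (n + 1) - a n := by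
    intro n
    induction n with
    | zero =>
      rw [SS, S0, aS, a0, mul_zero, add_zero, sub_zero, norm_smul]
      norm_num
      linarith
    | succ n ih =>
      have h : S (n + 2) - S (n + 1) = (2⁻¹ : ℝ) •
          (S (n + 1) * (S (n + 1) - S n) + (S (n + 1) - S n) * S n) := by
        have h' : S (n + 2) - S (n + 1) = (2⁻¹ : ℝ) •
            ((K + S (n + 1) * S (n + 1)) - (K + S n * S n)) := by
          rw [smul_sub, ← SS (n + 1), ← SS n]
        rw [h']
        congr 1
        noncomm_ring
      have hd : 0 ≤ a (n + 1) - a n := (norm_nonneg _).trans ih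
      have h1 : ‖S (n + 1) * (S (n + 1) - S n)‖ ≤ a (n + 1) * (a (n + 1) - a n) :=
        (norm_mul_le _ _).trans (mul_le_mul (hS _) ih (norm_nonneg _) (ha _).1)
      have h2 : ‖(S (n + 1) - S n) * S n‖ ≤ (a (n + 1) - a n) * a n :=
        (norm_mul_le _ _).trans (mul_le_mul ih (hS _) (norm_nonneg _) hd)
      have h3 := norm_add_le (S (n + 1) * (S (n + 1) - S n)) ((S (n + 1) - S n) * S n)
      have e1 : a (n + 1 + 1) = (1 + a (n + 1) ^ 2) / 2 := aS (n + 1)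
      rw [h, norm_smul, e1]
      nth_rewrite 2 [aS n]
      norm_num
      nlinarith
  have hmono : Monotone a := monotone_nat_of_le_succ fun n => by
    have := (norm_nonneg _).trans (hstep n); linarith
  have hsum : Summable fun n => a (n + 1) - a n := by
    refine summable_of_sum_range_le (c := 1)
      (fun n => (norm_nonneg _).trans (hstep n)) fun n => ?_
    rw [Finset.sum_range_sub, a0, sub_zero]
    exact (ha n).2
  have hc : CauchySeq S := cauchySeq_of_dist_le_of_summable _
    (fun n => by rw [dist_comm, dist_eq_norm]; exact hstep n) hsum
  obtain ⟨L, hL⟩ := cauchySeq_tendsto_of_complete hc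
  have hsa : ∀ n, IsSelfAdjoint (S n) := by
    intro n
    induction n with
    | zero => rw [S0]; exact IsSelfAdjoint.zero _
    | succ n ih =>
      rw [SS]
      refine IsSelfAdjoint.smul (by simp [IsSelfAdjoint]) (hK.add ?_)
      simpa [pow_two] using ih.pow 2
  have hLsa : IsSelfAdjoint L := by
    have h1 : Tendsto (fun n => star (S n)) atTop (𝓝 (star L)) :=
      (continuous_star.tendsto L).comp hL
    have h2 : (fun n => star (S n)) = S := funext fun n => hsa n
    rw [h2] at h1
    exact tendsto_nhds_unique h1 hL
  have hL1 : ‖L‖ ≤ 1 := le_of_tendsto hL.norm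
    (Eventually.of_forall fun n => (hS n).trans (ha n).2)
  have hfix : L = (2⁻¹ : ℝ) • (K + L * L) := by
    refine tendsto_nhds_unique ((tendsto_add_atTop_iff_nat 1).2 hL) ?_
    simp only [SS]
    exact ((tendsto_const_nhds.add (hL.mul hL)).const_smul (2⁻¹ : ℝ))
  refine ⟨1 - L, ?_, ?_⟩
  · rw [ContinuousLinearMap.isPositive_def]
    refine ⟨((IsSelfAdjoint.one _).sub hLsa).isSymmetric, fun x => ?_⟩
    have h1 : ⟪L x, x⟫ ≤ ‖x‖ * ‖x‖ := (real_inner_le_norm _ _).trans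
      (mul_le_mul_of_nonneg_right ((L.le_opNorm x).trans
        (mul_le_of_le_one_left (norm_nonneg _) hL1)) (norm_nonneg _))
    have h2 : ⟪x, x⟫ = ‖x‖ * ‖x‖ := real_inner_self_eq_norm_mul_norm x
    simp [ContinuousLinearMap.reApplyInnerSelf_apply, inner_sub_left] at *
    linarith
  · have h2 : (2 : ℝ) • L = K + L * L := by
      nth_rewrite 1 [hfix]
      rw [smul_smul]; norm_num
    have h3 : L + L = K + L * L := by rw [← h2, two_smul]
    have h4 : (1 - L) * (1 - L) = 1 - (L + L) + L * L := by noncomm_ring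
    rw [h4, h3]; abel

/-- Every nonnegative self-adjoint bounded operator has a nonnegative square root. -/
theorem exists_posSqrt {R : H →L[ℝ] H} (hR : R.IsPositive) :
    ∃ P : H →L[ℝ] H, P.IsPositive ∧ P.comp P = R := by
  have hsymm : ∀ x y, ⟪R x, y⟫ = ⟪x, R y⟫ := hR.isSymmetric
  have hpos : ∀ x, 0 ≤ ⟪R x, x⟫ := fun x => hR.inner_nonneg_left x
  set c : ℝ := ‖R‖ + 1 with hc
  have hc0 : 0 < c := by positivity
  have hsa : IsSelfAdjoint ((1 : H →L[ℝ] H) - c⁻¹ • R) :=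
    (IsSelfAdjoint.one _).sub (IsSelfAdjoint.smul (by simp [IsSelfAdjoint]) hR.isSelfAdjoint)
  have hn : ‖(1 : H →L[ℝ] H) - c⁻¹ • R‖ ≤ 1 := by
    refine ContinuousLinearMap.opNorm_le_bound _ zero_le_one fun x => ?_
    rw [one_mul]
    refine le_of_sq_le_sq ?_ (norm_nonneg _)
    have h1 : ‖R x‖ ^ 2 ≤ c * ⟪R x, x⟫ := by
      have h := hpos (c • x - R x)
      have h2 : ⟪R (R x), R x⟫ ≤ c * ‖R x‖ ^ 2 := by
        refine (real_inner_le_norm _ _).trans ?_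
        have := R.le_opNorm (R x)
        nlinarith [norm_nonneg (R x), sq_nonneg ‖R x‖]
      have h3 : ⟪R (R x), x⟫ = ‖R x‖ ^ 2 := by rw [hsymm, real_inner_self_eq_norm_sq]
      simp only [map_sub, map_smul, inner_sub_left, inner_sub_right, inner_smul_left,
        inner_smul_right, real_inner_self_eq_norm_sq, h3] at h
      simp at h
      nlinarith
    have h4 : ‖((1 : H →L[ℝ] H) - c⁻¹ • R) x‖ ^ 2
        = ‖x‖ ^ 2 - 2 * c⁻¹ * ⟪R x, x⟫ + c⁻¹ ^ 2 * ‖R x‖ ^ 2 := by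
      show ‖x - c⁻¹ • R x‖ ^ 2 = _
      rw [norm_sub_sq_real, norm_smul, inner_smul_right, real_inner_comm, mul_pow]
      simp; ring
    rw [h4]
    have h5 : c⁻¹ ^ 2 * ‖R x‖ ^ 2 ≤ c⁻¹ * ⟪R x, x⟫ := by
      calc c⁻¹ ^ 2 * ‖R x‖ ^ 2 ≤ c⁻¹ ^ 2 * (c * ⟪R x, x⟫) := by gcongr
        _ = c⁻¹ * ⟪R x, x⟫ := by field_simp
    have h6 : 0 ≤ c⁻¹ * ⟪R x, x⟫ := mul_nonneg (by positivity) (hpos x)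
    linarith
  obtain ⟨P, hP, hPP⟩ := exists_sqrt_aux _ hsa hn
  refine ⟨Real.sqrt c • P, ?_, ?_⟩
  · exact hP.smul_of_nonneg (by positivity)
  · have h : P * P = c⁻¹ • R := by rw [hPP]; abel
    have h' : P.comp P = c⁻¹ • R := h
    rw [ContinuousLinearMap.smul_comp, ContinuousLinearMap.comp_smul, h', smul_smul, smul_smul,
      Real.mul_self_sqrt hc0.le, mul_inv_cancel₀ hc0.ne', one_smul]

open Classical in
/-- The nonnegative self-adjoint square root `R^{1/2}` of a nonnegative self-adjoint bounded
operator `R` on a Hilbert space; it exists and is unique for every such `R`. -/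
noncomputable def posSqrt (R : H →L[ℝ] H) : H →L[ℝ] H :=
  if h : ∃ P : H →L[ℝ] H, P.IsPositive ∧ P.comp P = R then h.choose else 0

theorem posSqrt_spec {R : H →L[ℝ] H} (hR : R.IsPositive) :
    (posSqrt R).IsPositive ∧ (posSqrt R).comp (posSqrt R) = R := by
  rw [posSqrt, dif_pos (exists_posSqrt hR)]
  exact (exists_posSqrt hR).choose_spec

/-- Every vector in the range of `R` has exactly one preimage orthogonal to the kernel. -/
theorem existsUnique_preimage (R : H →L[ℝ] H) {z : H} (hz : z ∈ range R) :
    ∃! y : H, y ∈ (R.ker)ᗮ ∧ R y = z := by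
  obtain ⟨y, rfl⟩ := hz
  have : CompleteSpace R.ker := R.isClosed_ker.completeSpace_coe
  refine ⟨y - R.ker.starProjection y, ⟨Submodule.sub_starProjection_mem_orthogonal y, ?_⟩, ?_⟩
  · have h : R (R.ker.starProjection y) = 0 := Submodule.starProjection_apply_mem R.ker y
    show R (y - R.ker.starProjection y) = R y
    rw [map_sub, h, sub_zero]
  · rintro w ⟨hw, hRw⟩
    rw [← sub_eq_zero]
    have h1 : w - (y - R.ker.starProjection y) ∈ (R.ker)ᗮ :=
      Submodule.sub_mem _ hw (Submodule.sub_starProjection_mem_orthogonal y)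
    have h2 : w - (y - R.ker.starProjection y) ∈ R.ker := by
      have h : R (R.ker.starProjection y) = 0 := Submodule.starProjection_apply_mem R.ker y
      show R (w - (y - R.ker.starProjection y)) = 0
      have hRw' : R w = R y := hRw
      rw [map_sub, map_sub, h, hRw', sub_zero, sub_self]
    exact inner_self_eq_zero.1 (h1 _ h2)

/-- The bounded operator `R⁻¹ S`, for operators with `S(H) ⊆ R(H)`: it maps `x` to the preimage
of `S x` under `R` (the one orthogonal to the kernel of `R`, in case `R` is not injective). -/
noncomputable def invComp (R S : H →L[ℝ] H) (h : range S ⊆ range R) : H →L[ℝ] H :=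
  have hmem : ∀ x, S x ∈ range R := fun x => h ⟨x, rfl⟩
  let L : H →ₗ[ℝ] H :=
    { toFun := fun x => (existsUnique_preimage R (hmem x)).choose
      map_add' := fun x y => by
        have hx := (existsUnique_preimage R (hmem x)).choose_spec.1
        have hy := (existsUnique_preimage R (hmem y)).choose_spec.1
        refine ((existsUnique_preimage R (hmem (x + y))).choose_spec.2 _
          ⟨Submodule.add_mem _ hx.1 hy.1, ?_⟩).symm
        rw [map_add, hx.2, hy.2, map_add]
      map_smul' := fun c x => by
        have hx := (existsUnique_preimage R (hmem x)).choose_spec.1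
        refine ((existsUnique_preimage R (hmem (c • x))).choose_spec.2 _
          ⟨Submodule.smul_mem _ c hx.1, ?_⟩).symm
        rw [map_smul, hx.2, map_smul] }
  ⟨L, L.continuous_of_seq_closed_graph fun u x y hu hLu => by
    have hspec : ∀ z, L z ∈ (R.ker)ᗮ ∧ R (L z) = S z := fun z =>
      (existsUnique_preimage R (hmem z)).choose_spec.1
    refine (existsUnique_preimage R (hmem x)).choose_spec.2 y ⟨?_, ?_⟩
    · exact (Submodule.isClosed_orthogonal _).mem_of_tendsto hLu
        (Eventually.of_forall fun n => (hspec _).1)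
    · refine tendsto_nhds_unique ((R.continuous.tendsto y).comp hLu) ?_
      have : (R ∘ L ∘ u) = S ∘ u := funext fun n => (hspec (u n)).2
      rw [this]
      exact (S.continuous.tendsto x).comp hu⟩

theorem apply_invComp (R S : H →L[ℝ] H) (h : range S ⊆ range R) (x : H) :
    R (invComp R S h x) = S x :=
  (existsUnique_preimage R (h ⟨x, rfl⟩)).choose_spec.1.2

variable [SecondCountableTopology H]

/-- The operator `Λ(t) = Q_t^{-1/2} e^{tA}`, defined when `e^{tA}(H) ⊆ Q_t^{1/2}(H)`. -/
noncomputable def lambdaOp (T : C0Semigroup H) (Q : H →L[ℝ] H) (t : ℝ)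
    (h : range (T.op t) ⊆ range (posSqrt (covOp T Q t))) : H →L[ℝ] H :=
  invComp (posSqrt (covOp T Q t)) (T.op t) h

end Operators

/-! ### Gaussian measures, the Ornstein–Uhlenbeck semigroup and the iteration -/

section Iteration

variable {H : Type*} [NormedAddCommGroup H] [InnerProductSpace ℝ H] [CompleteSpace H]
  [SecondCountableTopology H] [MeasurableSpace H] [BorelSpace H]

/-- Existence of centred Gaussian measures with nonnegative trace class covariance. -/
theorem exists_gaussianLaw {R : H →L[ℝ] H} (hR : R.IsPositive) (htr : IsTraceClass R) :
    ∃ μ : Measure H, IsProbabilityMeasure μ ∧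
      ∀ y : H, charFun μ y = Complex.exp (-((⟪R y, y⟫ / 2 : ℝ) : ℂ)) := by
  obtain ⟨P, hP, hPR⟩ := exists_posSqrt hR
  obtain ⟨w, e, -⟩ := exists_hilbertBasis ℝ H
  have hPsymm : ∀ x y, ⟪P x, y⟫ = ⟪x, P y⟫ := hP.isSymmetric
  have hPP : ∀ x, P (P x) = R x := fun x => by rw [← hPR]; rfl
  let ν : Measure (w → ℝ) := Measure.infinitePi fun _ : w => gaussianReal 0 1
  have hmp : ∀ i : w, MeasurePreserving (fun ω : w → ℝ => ω i) ν (gaussianReal 0 1) :=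
    fun i => measurePreserving_eval_infinitePi (fun _ : w => gaussianReal 0 1) i
  have hindep : iIndepFun (fun (i : w) (ω : w → ℝ) => ω i) ν :=
    iIndepFun_infinitePi (P := fun _ : w => gaussianReal 0 1) (X := fun _ r => r)
      fun _ => measurable_id
  have hmem : ∀ i : w, MemLp (fun ω : w → ℝ => ω i) 2 ν := fun i =>
    (memLp_id_gaussianReal' 2 (by norm_num)).comp_measurePreserving (hmp i)
  have hmemv : ∀ (i : w) (x : H), MemLp (fun ω : w → ℝ => ω i • x) 2 ν := fun i x =>
    (ContinuousLinearMap.toSpanSingleton ℝ x).comp_memLp' (hmem i)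
  have hmean : ∀ i : w, ∫ ω, ω i ∂ν = 0 := fun i => by
    have h := (hmp i).map_eq
    have h2 := integral_map (μ := ν) (φ := fun ω : w → ℝ => ω i) (f := fun r : ℝ => r)
      (hmp i).measurable.aemeasurable (by fun_prop)
    rw [h, integral_id_gaussianReal] at h2
    exact h2.symm
  have hvar : ∀ i : w, ∫ ω, ω i * ω i ∂ν = 1 := fun i => by
    have h := (hmp i).map_eq
    have h2 := integral_map (μ := ν) (φ := fun ω : w → ℝ => ω i) (f := fun r : ℝ => r * r)
      (hmp i).measurable.aemeasurable (by fun_prop)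
    rw [h] at h2
    rw [← h2]
    have h3 := variance_id_gaussianReal (μ := 0) (v := 1)
    rw [variance_eq_sub (memLp_id_gaussianReal' 2 (by norm_num))] at h3
    simpa [integral_id_gaussianReal, pow_two] using h3
  have hcov : ∀ i j : w, i ≠ j → ∫ ω, ω i * ω j ∂ν = 0 := fun i j hij => by
    rw [(hindep.indepFun hij).integral_fun_mul_eq_mul_integral
      (hmem i).1 (hmem j).1, hmean, zero_mul]
  have hinner : ∀ (i j : w) (x y : H),
      ⟪(hmemv i x).toLp, (hmemv j y).toLp⟫ = (∫ ω, ω i * ω j ∂ν) * ⟪x, y⟫ := by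
    intro i j x y
    rw [L2.inner_def, ← integral_mul_const]
    refine integral_congr_ae ?_
    filter_upwards [(hmemv i x).coeFn_toLp, (hmemv j y).coeFn_toLp] with ω h1 h2
    rw [h1, h2, inner_smul_left, inner_smul_right]
    simp [mul_assoc]
  let V : w → H →ₗᵢ[ℝ] Lp H 2 ν := fun i =>
    { toFun := fun x => (hmemv i x).toLp
      map_add' := fun x y => by
        rw [← MemLp.toLp_add]
        congr 1
        funext ω
        simp
      map_smul' := fun c x => by
        rw [RingHom.id_apply, ← MemLp.toLp_const_smul]
        congr 1
        funext ω
        exact smul_comm _ _ _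
      norm_map' := fun x => by
        have h := hinner i i x x
        rw [hvar, one_mul, real_inner_self_eq_norm_sq, real_inner_self_eq_norm_sq] at h
        exact (sq_eq_sq₀ (norm_nonneg _) (norm_nonneg _)).1 h }
  have hV : OrthogonalFamily ℝ (fun _ : w => H) V := fun i j hij x y => by
    have h := hinner i j x y
    rwa [hcov i j hij, zero_mul] at h
  have hsum : Summable fun i : w => V i (P (e i)) := by
    rw [hV.summable_iff_norm_sq_summable]
    refine (htr.summable_inner hR e).congr fun i => ?_
    rw [← hPP, hPsymm, real_inner_self_eq_norm_sq]
  obtain ⟨X, hX⟩ := hsum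
  refine ⟨ν.map X, Measure.isProbabilityMeasure_map (Lp.aestronglyMeasurable X).aemeasurable,
    fun y => ?_⟩
  have hlim1 : Tendsto (fun F : Finset w =>
      ∫ ω, Complex.exp (⟪(∑ i ∈ F, V i (P (e i)) : Lp H 2 ν) ω, y⟫ * Complex.I) ∂ν) atTop
      (𝓝 (charFun (ν.map X) y)) := by
    have hc : charFun (ν.map X) y = ∫ ω, Complex.exp (⟪X ω, y⟫ * Complex.I) ∂ν := by
      rw [charFun_apply, integral_map (Lp.aestronglyMeasurable X).aemeasurable
        (by fun_prop)]
    rw [hc, tendsto_iff_norm_sub_tendsto_zero]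
    refine squeeze_zero (fun _ => norm_nonneg _)
      (fun F => norm_integral_exp_sub_le ν _ X y) ?_
    have h := (tendsto_iff_norm_sub_tendsto_zero.1 hX).mul_const ‖y‖
    simpa using h
  have hfin : ∀ F : Finset w,
      ∫ ω, Complex.exp (⟪(∑ i ∈ F, V i (P (e i)) : Lp H 2 ν) ω, y⟫ * Complex.I) ∂ν
        = Complex.exp (-((∑ i ∈ F, ⟪P y, e i⟫ * ⟪e i, P y⟫ : ℝ) / 2 : ℂ)) := by
    intro F
    have hae : ∀ᵐ ω ∂ν, (∑ i ∈ F, V i (P (e i)) : Lp H 2 ν) ω = ∑ i ∈ F, ω i • P (e i) := by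
      have h1 := Lp.coeFn_finsetSum F (fun i => V i (P (e i)))
      have h2 : ∀ᵐ ω ∂ν, ∀ i ∈ F, (V i (P (e i)) : Lp H 2 ν) ω = ω i • P (e i) :=
        (Finset.eventually_all F).2 fun i _ => (hmemv i (P (e i))).coeFn_toLp
      filter_upwards [h1, h2] with ω h1 h2
      rw [h1]
      simp only [Finset.sum_apply]
      exact Finset.sum_congr rfl h2
    let Y : w → (w → ℝ) → ℝ := fun i ω => ⟪P (e i), y⟫ * ω i
    have hY : ∀ i, Measurable (Y i) := fun i => (measurable_pi_apply i).const_mul _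
    have hYi : iIndepFun Y ν := hindep.comp (fun i r => ⟪P (e i), y⟫ * r)
      fun i => measurable_const_mul _
    have h1 : ∫ ω, Complex.exp (⟪(∑ i ∈ F, V i (P (e i)) : Lp H 2 ν) ω, y⟫ * Complex.I) ∂ν
        = charFun (ν.map fun ω => ∑ i ∈ F, Y i ω) 1 := by
      rw [charFun_apply_real, integral_map (Finset.measurable_fun_sum _ fun i _ => hY i).aemeasurable
        (by fun_prop)]
      refine integral_congr_ae ?_
      filter_upwards [hae] with ω hω
      rw [hω, sum_inner]
      simp [Y, inner_smul_left, mul_comm]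
    rw [h1, iIndepFun.charFun_map_fun_finsetSum_eq_prod (fun i _ => (hY i).aemeasurable)
      (hYi.restrict _), Finset.prod_apply]
    have h2 : ∀ i, charFun (ν.map (Y i)) 1
        = Complex.exp (-((⟪P y, e i⟫ * ⟪e i, P y⟫ : ℝ) / 2 : ℂ)) := by
      intro i
      have h3 := charFun_map_mul_comp (μ := ν) (f := fun ω : w → ℝ => ω i)
        (hmp i).measurable.aemeasurable ⟪P (e i), y⟫ 1
      rw [(hmp i).map_eq, charFun_gaussianReal] at h3
      refine h3.trans ?_
      congr 1
      rw [hPsymm, real_inner_comm (P y) (e i)]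
      push_cast
      ring
    simp_rw [h2]
    rw [← Complex.exp_sum]
    congr 1
    push_cast
    rw [Finset.sum_neg_distrib, Finset.sum_div]
  have hlim2 : Tendsto (fun F : Finset w =>
      Complex.exp (-((∑ i ∈ F, ⟪P y, e i⟫ * ⟪e i, P y⟫ : ℝ) / 2 : ℂ))) atTop
      (𝓝 (Complex.exp (-((⟪P y, P y⟫ : ℝ) / 2 : ℂ)))) := by
    have h := e.hasSum_inner_mul_inner (P y) (P y)
    exact (((by fun_prop : Continuous fun r : ℝ =>
      Complex.exp (-((r : ℂ) / 2)))).tendsto _).comp h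
  simp_rw [hfin] at hlim1
  rw [tendsto_nhds_unique hlim1 hlim2, ← hPsymm, hPP]
  push_cast
  rfl

open Classical in
/-- The centred Gaussian measure `N_R` on `H` with covariance operator `R`, that is, the Borel
probability measure with characteristic function `h ↦ exp (-⟪R h, h⟫ / 2)`; it exists and is
unique for every nonnegative self-adjoint trace class operator `R`. -/
noncomputable def gaussianLaw (R : H →L[ℝ] H) : Measure H :=
  if h : ∃ μ : Measure H, IsProbabilityMeasure μ ∧
      ∀ y : H, charFun μ y = Complex.exp (-((⟪R y, y⟫ / 2 : ℝ) : ℂ))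
  then h.choose else 0

theorem gaussianLaw_spec {R : H →L[ℝ] H} (hR : R.IsPositive) (htr : IsTraceClass R) :
    IsProbabilityMeasure (gaussianLaw R) ∧
      ∀ y : H, charFun (gaussianLaw R) y = Complex.exp (-((⟪R y, y⟫ / 2 : ℝ) : ℂ)) := by
  rw [gaussianLaw, dif_pos (exists_gaussianLaw hR htr)]
  exact (exists_gaussianLaw hR htr).choose_spec

/-- The measure `N_R` is determined by its characteristic function. -/
theorem gaussianLaw_unique {R : H →L[ℝ] H} (hR : R.IsPositive) (htr : IsTraceClass R)
    (μ : Measure H) [IsProbabilityMeasure μ]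
    (hμ : ∀ y : H, charFun μ y = Complex.exp (-((⟪R y, y⟫ / 2 : ℝ) : ℂ))) :
    μ = gaussianLaw R := by
  have h := gaussianLaw_spec hR htr
  have := h.1
  exact Measure.ext_of_charFun (funext fun y => (hμ y).trans (h.2 y).symm)

/-- The semigroup of the linear equation `dZ = AZ dt + √Q dW`, `Z_0 = x`, whose solution at
time `t` has the law of `e^{tA} x + Y` with `Y` of law `N_{Q_t}`:
`S_t f (x) = E f(Z_t^x) = ∫ f(e^{tA} x + y) N_{Q_t}(dy)`. -/
noncomputable def ouSemigroup (T : C0Semigroup H) (Q : H →L[ℝ] H) (t : ℝ) (f : H → ℝ) (x : H) :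
    ℝ :=
  ∫ y, f (T.op t x + y) ∂gaussianLaw (covOp T Q t)

/-- The iterates `v^n(t, x)`: `v^0(t, x) = S_t u₀ (x)` and
`v^{n+1}(t, x) = ∫_0^t (S_{t-s} ⟨B, D v^n(s)⟩)(x) ds`, where `D` is the Fréchet derivative in
the space variable, identified with the gradient. -/
noncomputable def iterTerm (T : C0Semigroup H) (Q : H →L[ℝ] H) (u₀ : H → ℝ) (B : H → H) :
    ℕ → ℝ → H → ℝ
  | 0, t, x => ouSemigroup T Q t u₀ x
  | n + 1, t, x =>
      ∫ s in (0 : ℝ)..t,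
        ouSemigroup T Q (t - s) (fun y => ⟪B y, gradient (iterTerm T Q u₀ B n s) y⟫) x

/-- The function `k^n_s(y) = ⟨B(y), D v^n(s, y)⟩`. -/
noncomputable def driftTerm (T : C0Semigroup H) (Q : H →L[ℝ] H) (u₀ : H → ℝ) (B : H → H)
    (n : ℕ) (s : ℝ) (y : H) : ℝ :=
  ⟪B y, gradient (iterTerm T Q u₀ B n s) y⟫

end Iteration

/-! ### Bounded functions -/

section Bounded

/-- `f` is a bounded function. -/
def IsBoundedFun {X E : Type*} [Norm E] (f : X → E) : Prop :=
  ∃ C : ℝ, ∀ x, ‖f x‖ ≤ C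

/-- The uniform norm `‖f‖_∞ = sup_x ‖f x‖` of a bounded function. -/
noncomputable def supNorm {X E : Type*} [Norm E] (f : X → E) : ℝ :=
  ⨆ x, ‖f x‖

variable {H : Type*} [NormedAddCommGroup H] [InnerProductSpace ℝ H] [CompleteSpace H]

/-- `C_b^1(H)`: bounded Fréchet differentiable functions with bounded derivative. -/
def IsCb1 (f : H → ℝ) : Prop :=
  Differentiable ℝ f ∧ IsBoundedFun f ∧ IsBoundedFun (gradient f)

end Bounded

end Kolmogorov

open Kolmogorov

namespace Kolmogorov

/-! ### Smoothing by the standard Gaussian measure on the line -/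

/-! The engine is the smoothing estimate ‖D S_t f‖ ≤ ‖Λ(t)‖ ‖f‖ ≤ C t^{-δ} ‖f‖ in sup norms. Write P
= Q_t^{1/2}. Since e^{tA} = P Λ(t), S_t f = Φ ∘ Λ(t) with Φ(w) = ∫ f(P w + y) N_{Q_t}(dy), so it
suffices that Φ is Fréchet differentiable with ‖DΦ‖ ≤ ‖f‖. No infinite-dimensional Cameron–Martin
theorem is needed. For a unit vector e, N_{Q_t} is the law of Y + ξ P e with ξ standard normal and Y
an independent centred Gaussian (`gaussianLaw_eq_map_prod`). Along direction e, Φ is therefore a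
one-dimensional Gaussian convolution, and the explicit density exp(rξ - r²/2) gives a first-order
coefficient bounded by ‖f‖ and a remainder at most ‖f‖ r² (`exists_gaussianReal_taylor`). These
bounds are uniform in base point and direction, which forces linearity of the directional
derivatives and Fréchet differentiability (`exists_hasFDerivAt_of_taylor_lines`). The estimates then
follow by induction. With a = (n+1)(1-δ), the drift k^n_s is bounded by β s^{a-1}. Contractivity of
S gives |v^{n+1}(t)| ≤ β t^a / a, and smoothing gives ‖Dv^{n+1}(t)‖ ≤ β C ∫_0^t s^{a-1} (t-s)^{-δ}
ds, a Beta integral whose Gamma quotients telescope in n. The remaining burden is measurability. The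
characteristic function of N_{Q_t} is continuous in t, so t ↦ N_{Q_t} is a measurable kernel
(`measurable_of_continuous_charFun`), and gradients are limits of difference quotients. Each iterate
thus has a jointly measurable version for t > 0, which the induction carries along with the bounds.
-/

/-- Cameron–Martin on the line: translate Lebesgue measure and compare densities. The integrands
agree pointwise after the translation, so `h` needs no regularity. -/
theorem integral_gaussianReal_comp_add (h : ℝ → ℝ) (r : ℝ) :
    ∫ ξ, h (ξ + r) ∂gaussianReal 0 1 =
      ∫ ξ, h ξ * Real.exp (r * ξ - r ^ 2 / 2) ∂gaussianReal 0 1 := by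
  rw [integral_gaussianReal_eq_integral_smul one_ne_zero,
    integral_gaussianReal_eq_integral_smul one_ne_zero,
    ← integral_add_right_eq_self _ (-r)]
  refine integral_congr_ae (Eventually.of_forall fun u => ?_)
  simp only [gaussianPDFReal, smul_eq_mul, neg_add_cancel_right]
  have : Real.exp (-(u + -r - 0) ^ 2 / (2 * ((1 : NNReal) : ℝ)))
      = Real.exp (-(u - 0) ^ 2 / (2 * ((1 : NNReal) : ℝ))) * Real.exp (r * u - r ^ 2 / 2) := by
    rw [← Real.exp_add]
    congr 1
    push_cast
    ring
  rw [this]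
  ring

theorem integrable_sq_gaussianReal : Integrable (fun ξ : ℝ => ξ ^ 2) (gaussianReal 0 1) :=
  (memLp_id_gaussianReal' (μ := 0) (v := 1) 2 (by norm_num)).integrable_sq

theorem integral_sq_gaussianReal : ∫ ξ, ξ ^ 2 ∂gaussianReal 0 1 = 1 := by
  have h := variance_id_gaussianReal (μ := 0) (v := 1)
  rw [variance_eq_sub (memLp_id_gaussianReal' 2 (by norm_num))] at h
  simpa [integral_id_gaussianReal] using h

theorem integrable_id_gaussianReal : Integrable (fun ξ : ℝ => ξ) (gaussianReal 0 1) :=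
  (memLp_id_gaussianReal' (μ := 0) (v := 1) 1 (by norm_num)).integrable le_rfl

/-- The variance of |X| is nonnegative. This converts the second moments computed for Gaussian
densities into first-moment bounds. -/
theorem integral_abs_le_of_integral_sq_le {Ω : Type*} [MeasurableSpace Ω] {ν : Measure Ω}
    [IsProbabilityMeasure ν] {X : Ω → ℝ} (hX : Integrable (fun ω => X ω ^ 2) ν) {a : ℝ}
    (hm : AEStronglyMeasurable X ν) (ha : 0 ≤ a) (h : ∫ ω, X ω ^ 2 ∂ν ≤ a ^ 2) :
    ∫ ω, |X ω| ∂ν ≤ a := by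
  have hL : MemLp X 2 ν := (memLp_two_iff_integrable_sq hm).2 hX
  have hv := variance_nonneg |X| ν
  rw [variance_eq_sub hL.abs] at hv
  refine abs_le_of_sq_le_sq' ?_ ha |>.2
  have : ∫ ω, (|X| ^ 2) ω ∂ν = ∫ ω, X ω ^ 2 ∂ν := by simp
  have h1 : ∫ ω, |X| ω ∂ν = ∫ ω, |X ω| ∂ν := rfl
  rw [h1] at hv
  linarith

/-- Measures how far the density w = exp(rξ - r²/2) is from its first-order expansion in r. The
moments E w = 1, E w² = exp(r²) and E ξw = r come from the shift identity applied to 1, w and ξ. -/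
theorem integral_exp_sub_one_sub_sq {r : ℝ} :
    Integrable (fun ξ => (Real.exp (r * ξ - r ^ 2 / 2) - 1 - r * ξ) ^ 2) (gaussianReal 0 1) ∧
    ∫ ξ, (Real.exp (r * ξ - r ^ 2 / 2) - 1 - r * ξ) ^ 2 ∂gaussianReal 0 1
      = Real.exp (r ^ 2) - 1 - r ^ 2 := by
  have hw : ∀ ξ : ℝ, Real.exp (r * ξ - r ^ 2 / 2) =
      Real.exp (r * ξ) * Real.exp (-(r ^ 2 / 2)) := fun ξ => by
    rw [← Real.exp_add]; congr 1
  have i1 : Integrable (fun ξ => Real.exp (r * ξ - r ^ 2 / 2)) (gaussianReal 0 1) := by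
    simp_rw [hw]
    exact (integrable_exp_mul_gaussianReal r).mul_const _
  have i2 : Integrable (fun ξ => Real.exp (r * ξ - r ^ 2 / 2) ^ 2) (gaussianReal 0 1) := by
    have : (fun ξ : ℝ => Real.exp (r * ξ - r ^ 2 / 2) ^ 2) =
        fun ξ => Real.exp (2 * r * ξ) * Real.exp (-(r ^ 2)) := by
      funext ξ
      rw [← Real.exp_add, pow_two, ← Real.exp_add]; congr 1; ring
    rw [this]
    exact (integrable_exp_mul_gaussianReal (2 * r)).mul_const _
  have m1 : MemLp (fun ξ => Real.exp (r * ξ - r ^ 2 / 2)) 2 (gaussianReal 0 1) :=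
    (memLp_two_iff_integrable_sq i1.1).2 i2
  have i3 : Integrable (fun ξ => ξ * Real.exp (r * ξ - r ^ 2 / 2)) (gaussianReal 0 1) :=
    (memLp_id_gaussianReal' (μ := 0) (v := 1) 2 (by norm_num)).integrable_mul m1
  have e1 : ∫ ξ, Real.exp (r * ξ - r ^ 2 / 2) ∂gaussianReal 0 1 = 1 := by
    have h := integral_gaussianReal_comp_add (fun _ => 1) r
    simpa using h.symm
  have e2 : ∫ ξ, Real.exp (r * ξ - r ^ 2 / 2) ^ 2 ∂gaussianReal 0 1 = Real.exp (r ^ 2) := by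
    have h := integral_gaussianReal_comp_add (fun ξ => Real.exp (r * ξ - r ^ 2 / 2)) r
    simp_rw [← pow_two] at h
    rw [← h]
    have : (fun ξ : ℝ => Real.exp (r * (ξ + r) - r ^ 2 / 2)) =
        fun ξ => Real.exp (r * ξ - r ^ 2 / 2) * Real.exp (r ^ 2) := by
      funext ξ
      rw [← Real.exp_add]; congr 1; ring
    rw [this, integral_mul_const, e1, one_mul]
  have e3 : ∫ ξ, ξ * Real.exp (r * ξ - r ^ 2 / 2) ∂gaussianReal 0 1 = r := by
    rw [← integral_gaussianReal_comp_add (fun ξ => ξ) r,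
      integral_add integrable_id_gaussianReal (integrable_const _), integral_id_gaussianReal]
    simp
  have hexp : (fun ξ : ℝ => (Real.exp (r * ξ - r ^ 2 / 2) - 1 - r * ξ) ^ 2) = fun ξ =>
      ((((Real.exp (r * ξ - r ^ 2 / 2) ^ 2 + r ^ 2 * ξ ^ 2)
        - 2 * Real.exp (r * ξ - r ^ 2 / 2)) - 2 * r * (ξ * Real.exp (r * ξ - r ^ 2 / 2)))
        + 2 * r * ξ) + 1 := by
    funext ξ; ring
  have j1 : Integrable (fun ξ => Real.exp (r * ξ - r ^ 2 / 2) ^ 2 + r ^ 2 * ξ ^ 2)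
      (gaussianReal 0 1) := i2.add (integrable_sq_gaussianReal.const_mul (r ^ 2))
  have j2 : Integrable (fun ξ => Real.exp (r * ξ - r ^ 2 / 2) ^ 2 + r ^ 2 * ξ ^ 2
      - 2 * Real.exp (r * ξ - r ^ 2 / 2)) (gaussianReal 0 1) := j1.sub (i1.const_mul 2)
  have j3 : Integrable (fun ξ => Real.exp (r * ξ - r ^ 2 / 2) ^ 2 + r ^ 2 * ξ ^ 2
      - 2 * Real.exp (r * ξ - r ^ 2 / 2) - 2 * r * (ξ * Real.exp (r * ξ - r ^ 2 / 2)))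
      (gaussianReal 0 1) := j2.sub (i3.const_mul (2 * r))
  have j4 : Integrable (fun ξ => Real.exp (r * ξ - r ^ 2 / 2) ^ 2 + r ^ 2 * ξ ^ 2
      - 2 * Real.exp (r * ξ - r ^ 2 / 2) - 2 * r * (ξ * Real.exp (r * ξ - r ^ 2 / 2))
      + 2 * r * ξ) (gaussianReal 0 1) := j3.add (integrable_id_gaussianReal.const_mul (2 * r))
  have e4 : ∫ ξ, 2 * r * ξ ∂gaussianReal 0 1 = 0 := by
    rw [integral_const_mul, integral_id_gaussianReal, mul_zero]
  rw [hexp]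
  refine ⟨j4.add (integrable_const _), ?_⟩
  rw [integral_add j4 (integrable_const _), integral_add j3
    (integrable_id_gaussianReal.const_mul (2 * r)), integral_sub j2 (i3.const_mul (2 * r)),
    integral_sub j1 (i1.const_mul 2), integral_add i2 (integrable_sq_gaussianReal.const_mul _)]
  simp only [integral_const_mul, e1, e2, e3, e4, integral_sq_gaussianReal,
    integral_const, probReal_univ, smul_eq_mul]
  ring

/-- Convolution with the standard Gaussian measure turns a bounded function into one with a
derivative bounded by the same bound, and a quadratic Taylor remainder. -/
theorem exists_gaussianReal_taylor {h : ℝ → ℝ} (hm : Measurable h) {M : ℝ}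
    (hM : ∀ ξ, |h ξ| ≤ M) :
    ∃ c : ℝ, |c| ≤ M ∧ ∀ r : ℝ, |r| ≤ 1 →
      |∫ ξ, h (ξ + r) ∂gaussianReal 0 1 - ∫ ξ, h ξ ∂gaussianReal 0 1 - r * c| ≤ M * r ^ 2 := by
  have hM0 : 0 ≤ M := (abs_nonneg _).trans (hM 0)
  have hmul : ∀ X : ℝ → ℝ, Integrable X (gaussianReal 0 1) →
      Integrable (fun ξ => h ξ * X ξ) (gaussianReal 0 1) ∧
      |∫ ξ, h ξ * X ξ ∂gaussianReal 0 1| ≤ M * ∫ ξ, |X ξ| ∂gaussianReal 0 1 := by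
    intro X hX
    refine ⟨hX.bdd_mul hm.aestronglyMeasurable (Eventually.of_forall hM), ?_⟩
    rw [← integral_const_mul, ← Real.norm_eq_abs]
    refine norm_integral_le_of_norm_le (hX.abs.const_mul M) (Eventually.of_forall fun ξ => ?_)
    rw [Real.norm_eq_abs, abs_mul]
    exact mul_le_mul_of_nonneg_right (hM ξ) (abs_nonneg _)
  -- The r-derivative of exp(rξ - r²/2) at 0 is ξ, so the first-order coefficient is E[h ξ]; then
  -- E|ξ| ≤ 1 bounds it by M.
  refine ⟨∫ ξ, h ξ * ξ ∂gaussianReal 0 1, ?_, fun r hr => ?_⟩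
  · refine (hmul _ integrable_id_gaussianReal).2.trans (mul_le_of_le_one_right hM0 ?_)
    exact integral_abs_le_of_integral_sq_le integrable_sq_gaussianReal
      integrable_id_gaussianReal.1 zero_le_one (by rw [integral_sq_gaussianReal]; norm_num)
  · obtain ⟨hi, he⟩ := integral_exp_sub_one_sub_sq (r := r)
    have hXm : AEStronglyMeasurable (fun ξ : ℝ => Real.exp (r * ξ - r ^ 2 / 2) - 1 - r * ξ)
        (gaussianReal 0 1) := by fun_prop
    have hX : Integrable (fun ξ : ℝ => Real.exp (r * ξ - r ^ 2 / 2) - 1 - r * ξ)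
        (gaussianReal 0 1) :=
      ((memLp_two_iff_integrable_sq hXm).2 hi).integrable (by norm_num)
    have hh : Integrable h (gaussianReal 0 1) := by
      simpa using (hmul (fun _ => 1) (integrable_const _)).1
    have hl := (hmul _ integrable_id_gaussianReal).1
    have key : ∫ ξ, h (ξ + r) ∂gaussianReal 0 1 - ∫ ξ, h ξ ∂gaussianReal 0 1
          - r * ∫ ξ, h ξ * ξ ∂gaussianReal 0 1 =
        ∫ ξ, h ξ * (Real.exp (r * ξ - r ^ 2 / 2) - 1 - r * ξ) ∂gaussianReal 0 1 := by
      have h1 : ∀ ξ : ℝ, h ξ * Real.exp (r * ξ - r ^ 2 / 2) =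
          h ξ * (Real.exp (r * ξ - r ^ 2 / 2) - 1 - r * ξ) + (h ξ + r * (h ξ * ξ)) := by
        intro ξ; ring
      have hs : Integrable (fun ξ => h ξ + r * (h ξ * ξ)) (gaussianReal 0 1) :=
        hh.add (hl.const_mul r)
      rw [integral_gaussianReal_comp_add]
      simp_rw [h1]
      rw [integral_add (hmul _ hX).1 hs,
        integral_add hh (hl.const_mul r), integral_const_mul]
      ring
    rw [key]
    refine (hmul _ hX).2.trans (mul_le_mul_of_nonneg_left ?_ hM0)
    refine integral_abs_le_of_integral_sq_le hi hXm (sq_nonneg r) ?_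
    rw [he]
    -- For 0 ≤ x ≤ 1, exp x - 1 - x ≤ x². With x = r² the second moment is at most (r²)², hence the
    -- first absolute moment at most r².
    have h1 : |r ^ 2| ≤ 1 := by
      rw [abs_pow]; exact pow_le_one₀ (abs_nonneg _) hr
    exact (le_abs_self _).trans (Real.abs_exp_sub_one_sub_id_le h1)

/-! ### Fréchet differentiability from uniform bounds along lines -/

/-- A function with uniform quadratic Taylor bounds along all lines is Fréchet differentiable. -/
theorem exists_hasFDerivAt_of_taylor_lines {E : Type*} [NormedAddCommGroup E] [NormedSpace ℝ E]
    {Φ : E → ℝ} {M : ℝ}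
    (h : ∀ w v : E, ∃ c : ℝ, |c| ≤ M * ‖v‖ ∧ ∀ r : ℝ, |r| * ‖v‖ ≤ 1 →
      |Φ (w + r • v) - Φ w - r * c| ≤ M * (r ^ 2 * ‖v‖ ^ 2)) (hM : 0 ≤ M) (w : E) :
    ∃ L : E →L[ℝ] ℝ, ‖L‖ ≤ M ∧ HasFDerivAt Φ L w := by
  choose D hDb hD using h
  -- The chosen coefficients `D w v` are forced to be directional derivatives, so their algebraic
  -- properties can be read off from uniqueness of limits.
  have hslope : ∀ w v : E, Tendsto (fun r : ℝ => r⁻¹ * (Φ (w + r • v) - Φ w)) (𝓝[≠] 0)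
      (𝓝 (D w v)) := by
    intro w v
    rw [tendsto_iff_norm_sub_tendsto_zero]
    have hlim : Tendsto (fun r : ℝ => M * (|r| * ‖v‖ ^ 2)) (𝓝[≠] 0) (𝓝 0) := by
      have : Tendsto (fun r : ℝ => M * (|r| * ‖v‖ ^ 2)) (𝓝 0) (𝓝 (M * (|0| * ‖v‖ ^ 2))) :=
        Continuous.tendsto (by fun_prop) 0
      simpa using this.mono_left nhdsWithin_le_nhds
    have hsmall : ∀ᶠ r : ℝ in 𝓝[≠] 0, |r| * ‖v‖ ≤ 1 := by
      have : Tendsto (fun r : ℝ => |r| * ‖v‖) (𝓝 0) (𝓝 (|0| * ‖v‖)) :=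
        Continuous.tendsto (by fun_prop) 0
      rw [abs_zero, zero_mul] at this
      exact (this.mono_left nhdsWithin_le_nhds).eventually_le_const one_pos
    refine squeeze_zero' (Eventually.of_forall fun _ => norm_nonneg _) ?_ hlim
    filter_upwards [hsmall, self_mem_nhdsWithin] with r hr hr0
    have hr0' : r ≠ 0 := hr0
    have h1 : r⁻¹ * (Φ (w + r • v) - Φ w) - D w v = r⁻¹ * (Φ (w + r • v) - Φ w - r * D w v) := by
      field_simp
    rw [h1, norm_mul, Real.norm_eq_abs, Real.norm_eq_abs, abs_inv]
    calc |r|⁻¹ * |Φ (w + r • v) - Φ w - r * D w v| ≤ |r|⁻¹ * (M * (r ^ 2 * ‖v‖ ^ 2)) :=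
          mul_le_mul_of_nonneg_left (hD w v r hr) (by positivity)
      _ = M * (|r| * ‖v‖ ^ 2) := by
          rw [← sq_abs r]
          have := abs_ne_zero.2 hr0'
          field_simp
  have hsmul : ∀ w v (a : ℝ), D w (a • v) = a * D w v := by
    intro w v a
    rcases eq_or_ne a 0 with rfl | ha
    · have := hDb w ((0 : ℝ) • v)
      rw [zero_smul, norm_zero, mul_zero] at this
      rw [zero_smul, zero_mul]
      exact abs_nonpos_iff.1 this
    · have h1 : Tendsto (fun r : ℝ => r * a) (𝓝[≠] 0) (𝓝[≠] 0) := by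
        refine tendsto_nhdsWithin_of_tendsto_nhds_of_eventually_within _ ?_ ?_
        · have : Tendsto (fun r : ℝ => r * a) (𝓝 0) (𝓝 (0 * a)) :=
            Continuous.tendsto (by fun_prop) 0
          rw [zero_mul] at this
          exact this.mono_left nhdsWithin_le_nhds
        · filter_upwards [self_mem_nhdsWithin] with r hr
          exact mul_ne_zero hr ha
      refine tendsto_nhds_unique (hslope w (a • v)) ((((hslope w v).comp h1).const_mul a).congr'
        (Eventually.of_forall fun r => ?_))
      simp only [Function.comp, smul_smul, mul_inv]
      field_simp
  -- The points w + 2ra and w + 2rb lie symmetrically about w + r(a+b) on a line of direction a - b.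
  -- Expanding from that midpoint cancels the linear terms and leaves a second difference of order
  -- r²; the midpoint moves with r, so the uniform constant M is essential.
  have hadd : ∀ w a b, D w (a + b) = D w a + D w b := by
    intro w a b
    have h2 : Tendsto (fun r : ℝ => 2 * (r⁻¹ * (Φ (w + r • (a + b)) - Φ w))
        - r⁻¹ * (Φ (w + r • ((2 : ℝ) • a)) - Φ w) - r⁻¹ * (Φ (w + r • ((2 : ℝ) • b)) - Φ w))
        (𝓝[≠] 0) (𝓝 (2 * D w (a + b) - D w ((2 : ℝ) • a) - D w ((2 : ℝ) • b))) :=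
      (((hslope w (a + b)).const_mul 2).sub (hslope _ _)).sub (hslope _ _)
    have h3 : Tendsto (fun r : ℝ => 2 * (r⁻¹ * (Φ (w + r • (a + b)) - Φ w))
        - r⁻¹ * (Φ (w + r • ((2 : ℝ) • a)) - Φ w) - r⁻¹ * (Φ (w + r • ((2 : ℝ) • b)) - Φ w))
        (𝓝[≠] 0) (𝓝 0) := by
      have hlim : Tendsto (fun r : ℝ => 2 * M * (|r| * ‖a - b‖ ^ 2)) (𝓝[≠] 0) (𝓝 0) := by
        have : Tendsto (fun r : ℝ => 2 * M * (|r| * ‖a - b‖ ^ 2)) (𝓝 0)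
            (𝓝 (2 * M * (|0| * ‖a - b‖ ^ 2))) :=
          Continuous.tendsto (by fun_prop) 0
        simpa using this.mono_left nhdsWithin_le_nhds
      have hsmall : ∀ᶠ r : ℝ in 𝓝[≠] 0, |r| * ‖a - b‖ ≤ 1 := by
        have : Tendsto (fun r : ℝ => |r| * ‖a - b‖) (𝓝 0) (𝓝 (|0| * ‖a - b‖)) :=
          Continuous.tendsto (by fun_prop) 0
        rw [abs_zero, zero_mul] at this
        exact (this.mono_left nhdsWithin_le_nhds).eventually_le_const one_pos
      rw [tendsto_zero_iff_norm_tendsto_zero]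
      refine squeeze_zero' (Eventually.of_forall fun _ => norm_nonneg _) ?_ hlim
      filter_upwards [hsmall, self_mem_nhdsWithin] with r hr hr0
      have hr0' : r ≠ 0 := hr0
      have e1 := hD (w + r • (a + b)) (a - b) r hr
      have e2 := hD (w + r • (a + b)) (a - b) (-r) (by rwa [abs_neg])
      have f1 : w + r • (a + b) + r • (a - b) = w + r • ((2 : ℝ) • a) := by module
      have f2 : w + r • (a + b) + (-r) • (a - b) = w + r • ((2 : ℝ) • b) := by module
      rw [f1] at e1
      rw [f2] at e2
      have h1 : 2 * (r⁻¹ * (Φ (w + r • (a + b)) - Φ w))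
          - r⁻¹ * (Φ (w + r • ((2 : ℝ) • a)) - Φ w) - r⁻¹ * (Φ (w + r • ((2 : ℝ) • b)) - Φ w)
          = r⁻¹ * (2 * Φ (w + r • (a + b)) - Φ (w + r • ((2 : ℝ) • a))
            - Φ (w + r • ((2 : ℝ) • b))) := by ring
      rw [h1, norm_mul, Real.norm_eq_abs, Real.norm_eq_abs, abs_inv]
      have h4 : |2 * Φ (w + r • (a + b)) - Φ (w + r • ((2 : ℝ) • a)) - Φ (w + r • ((2 : ℝ) • b))|
          ≤ 2 * M * (r ^ 2 * ‖a - b‖ ^ 2) := by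
        rw [abs_le] at *
        constructor <;> nlinarith [e1.1, e1.2, e2.1, e2.2]
      calc _ ≤ |r|⁻¹ * (2 * M * (r ^ 2 * ‖a - b‖ ^ 2)) :=
            mul_le_mul_of_nonneg_left h4 (by positivity)
        _ = 2 * M * (|r| * ‖a - b‖ ^ 2) := by
            rw [← sq_abs r]
            have := abs_ne_zero.2 hr0'
            field_simp
    have h5 := tendsto_nhds_unique h2 h3
    rw [hsmul, hsmul] at h5
    linarith
  let L : E →L[ℝ] ℝ := LinearMap.mkContinuous
    { toFun := D w, map_add' := hadd w, map_smul' := fun a v => hsmul w v a } M (hDb w)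
  refine ⟨L, LinearMap.mkContinuous_norm_le _ hM _, ?_⟩
  rw [hasFDerivAt_iff_isLittleO_nhds_zero]
  refine Asymptotics.IsBigO.trans_isLittleO (g := fun v : E => ‖v‖ ^ 2) ?_
    (Asymptotics.isLittleO_norm_pow_id one_lt_two)
  refine Asymptotics.IsBigO.of_bound M ?_
  filter_upwards [Metric.ball_mem_nhds (0 : E) one_pos] with v hv
  have hv1 : ‖v‖ < 1 := by simpa using hv
  -- Taking r = 1 gives remainder at most M‖v‖² on the unit ball, which is o(‖v‖).
  have := hD w v 1 (by simpa using hv1.le)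
  simpa [L] using this

end Kolmogorov

namespace Kolmogorov

/-! ### Smoothing by Gaussian measures on a Hilbert space -/

variable {H : Type*} [NormedAddCommGroup H] [InnerProductSpace ℝ H]

/-- Prepend the pair (-a, a) to a nuclear representation of `R`. -/
theorem IsTraceClass.sub_rankOne {R : H →L[ℝ] H} (h : IsTraceClass R) (a : H) :
    IsTraceClass (R - (innerSL ℝ a).smulRight a) := by
  obtain ⟨p, q, hs, hR⟩ := h
  refine ⟨fun n => Nat.casesOn n (-a) p, fun n => Nat.casesOn n a q, ?_, fun x => ?_⟩
  · rw [← summable_nat_add_iff 1]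
    exact hs
  · have := (hasSum_nat_add_iff (f := fun n : ℕ =>
      ⟪(Nat.casesOn n (-a) p : H), x⟫ • (Nat.casesOn n a q : H)) 1).1 (hR x)
    convert! this using 1
    simp [sub_eq_add_neg]

theorem isTraceClass_zero : IsTraceClass (0 : H →L[ℝ] H) :=
  ⟨0, 0, by simp [summable_zero], fun x => by simp [hasSum_zero]⟩

/-- Since ⟪Rx, x⟫ = ‖Px‖² and ⟪Pe, x⟫ = ⟪e, Px⟫, positivity is the Cauchy–Schwarz inequality. -/
theorem isPositive_sub_rankOne {R P : H →L[ℝ] H} (hP : P.IsPositive) (hPR : P.comp P = R)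
    {e : H} (he : ‖e‖ = 1) : (R - (innerSL ℝ (P e)).smulRight (P e)).IsPositive := by
  have hPsymm : ∀ x y, ⟪P x, y⟫ = ⟪x, P y⟫ := hP.isSymmetric
  have hPP : ∀ x, R x = P (P x) := fun x => by rw [← hPR]; rfl
  rw [ContinuousLinearMap.isPositive_def]
  constructor
  · intro x y
    show ⟪R x - ⟪P e, x⟫ • P e, y⟫ = ⟪x, R y - ⟪P e, y⟫ • P e⟫
    rw [inner_sub_left, inner_sub_right, hPP, hPP, hPsymm, hPsymm, real_inner_smul_left,
      real_inner_smul_right, real_inner_comm x (P e)]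
    ring
  · intro x
    show 0 ≤ ⟪R x - ⟪P e, x⟫ • P e, x⟫
    rw [inner_sub_left, hPP, hPsymm, real_inner_smul_left, hPsymm e, real_inner_self_eq_norm_sq]
    have h := abs_real_inner_le_norm e (P x)
    rw [he, one_mul] at h
    have h2 := sq_le_sq' (by linarith [(abs_le.1 h).1]) (abs_le.1 h).2
    nlinarith

variable [CompleteSpace H] [SecondCountableTopology H] [MeasurableSpace H] [BorelSpace H]

/-- Splitting off a one-dimensional Gaussian component in the direction `P e`, `P = R^{1/2}`. -/
theorem gaussianLaw_eq_map_prod {R P : H →L[ℝ] H} (hR : R.IsPositive) (htr : IsTraceClass R)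
    (hP : P.IsPositive) (hPR : P.comp P = R) {e : H} (he : ‖e‖ = 1) :
    gaussianLaw R =
      ((gaussianLaw (R - (innerSL ℝ (P e)).smulRight (P e))).prod (gaussianReal 0 1)).map
        (fun p => p.1 + p.2 • P e) := by
  set R' := R - (innerSL ℝ (P e)).smulRight (P e) with hR'
  obtain ⟨hprob, hchar⟩ := gaussianLaw_spec (isPositive_sub_rankOne hP hPR he)
    (htr.sub_rankOne (P e))
  rw [← hR'] at hprob hchar
  have hm : Measurable fun r : ℝ => r • P e := by fun_prop
  have hprob2 : IsProbabilityMeasure ((gaussianReal 0 1).map fun r : ℝ => r • P e) :=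
    Measure.isProbabilityMeasure_map hm.aemeasurable
  have hmap : ((gaussianLaw R').prod (gaussianReal 0 1)).map (fun p => p.1 + p.2 • P e) =
      (gaussianLaw R').conv ((gaussianReal 0 1).map fun r : ℝ => r • P e) := by
    rw [Measure.conv, ← Measure.map_id (μ := gaussianLaw R'), Measure.map_prod_map _ _
      measurable_id hm, Measure.map_map (by fun_prop) (by fun_prop), Measure.map_id]
    rfl
  have : IsProbabilityMeasure
      (((gaussianLaw R').prod (gaussianReal 0 1)).map (fun p => p.1 + p.2 • P e)) :=
    Measure.isProbabilityMeasure_map (by fun_prop)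
  -- Characteristic functions multiply under convolution, and ⟪R'y, y⟫ + ⟪Pe, y⟫² = ⟪Ry, y⟫.
  refine (gaussianLaw_unique hR htr _ fun y => ?_).symm
  rw [hmap, charFun_conv, hchar]
  have h1 : charFun ((gaussianReal 0 1).map fun r : ℝ => r • P e) y =
      charFun (gaussianReal 0 1) ⟪P e, y⟫ := by
    rw [charFun_apply, charFun_apply_real, integral_map hm.aemeasurable (by fun_prop)]
    refine integral_congr_ae (Eventually.of_forall fun r => ?_)
    simp only [real_inner_smul_left]
    push_cast
    ring_nf
  rw [h1, charFun_gaussianReal, ← Complex.exp_add]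
  congr 1
  have h2 : ⟪R' y, y⟫ = ⟪R y, y⟫ - ⟪P e, y⟫ * ⟪P e, y⟫ := by
    show ⟪R y - ⟪P e, y⟫ • P e, y⟫ = _
    rw [inner_sub_left, real_inner_smul_left]
  rw [h2]
  push_cast
  ring

theorem integrable_of_bounded {α : Type*} [MeasurableSpace α] {μ : Measure α} [IsFiniteMeasure μ]
    {f : α → ℝ} (hf : Measurable f) {M : ℝ} (hM : ∀ y, |f y| ≤ M) : Integrable f μ :=
  Integrable.of_bound hf.aestronglyMeasurable M (Eventually.of_forall hM)

theorem abs_integral_le_of_bounded {α : Type*} [MeasurableSpace α] {μ : Measure α}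
    [IsProbabilityMeasure μ] {f : α → ℝ} {M : ℝ} (hM : ∀ y, |f y| ≤ M) : |∫ y, f y ∂μ| ≤ M := by
  have := norm_integral_le_of_norm_le_const (μ := μ) (f := f) (Eventually.of_forall hM)
  simpa using this

/-- Averages of a bounded measurable function over the translates of `N_R` by vectors of the
Cameron–Martin space `R^{1/2}(H)` are differentiable along this space. -/
theorem exists_hasFDerivAt_integral_gaussianLaw {R P : H →L[ℝ] H} (hR : R.IsPositive)
    (htr : IsTraceClass R) (hP : P.IsPositive) (hPR : P.comp P = R) {f : H → ℝ}
    (hf : Measurable f) {M : ℝ} (hM : ∀ y, |f y| ≤ M) (x w : H) :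
    ∃ L : H →L[ℝ] ℝ, ‖L‖ ≤ M ∧
      HasFDerivAt (fun w => ∫ y, f (x + P w + y) ∂gaussianLaw R) L w := by
  have hM0 : 0 ≤ M := (abs_nonneg _).trans (hM 0)
  refine exists_hasFDerivAt_of_taylor_lines (fun w v => ?_) hM0 w
  rcases eq_or_ne v 0 with rfl | hv
  · exact ⟨0, by simp, fun r _ => by simp⟩
  have hv0 : 0 < ‖v‖ := norm_pos_iff.2 hv
  set e : H := ‖v‖⁻¹ • v with he
  have he1 : ‖e‖ = 1 := by rw [he, norm_smul]; simp [hv0.ne']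
  set R' := R - (innerSL ℝ (P e)).smulRight (P e) with hR'
  obtain ⟨hprob, -⟩ := gaussianLaw_spec (isPositive_sub_rankOne hP hPR he1)
    (htr.sub_rankOne (P e))
  rw [← hR'] at hprob
  have hbd : ∀ (z : H) (ξ : ℝ), |∫ y, f (z + y + ξ • P e) ∂gaussianLaw R'| ≤ M :=
    fun z ξ => abs_integral_le_of_bounded fun y => hM _
  have hmeas : Measurable fun ξ : ℝ => ∫ y, f (x + P w + y + ξ • P e) ∂gaussianLaw R' := by
    have h1 : Measurable fun p : ℝ × H => f (x + P w + p.2 + p.1 • P e) :=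
      hf.comp (by fun_prop)
    exact (h1.stronglyMeasurable.integral_prod_right (ν := gaussianLaw R')).measurable
  obtain ⟨c, hc, hT⟩ := exists_gaussianReal_taylor hmeas (hbd (x + P w))
  have hv' : v = ‖v‖ • e := by
    rw [he, smul_smul, mul_inv_cancel₀ hv0.ne', one_smul]
  -- As P(rv) = r‖v‖ P e, moving w along v shifts only the split-off scalar coordinate ξ, by r‖v‖.
  have hF : ∀ r : ℝ, ∫ y, f (x + P (w + r • v) + y) ∂gaussianLaw R =
      ∫ ξ, ∫ y, f (x + P w + y + (ξ + r * ‖v‖) • P e) ∂gaussianLaw R' ∂gaussianReal 0 1 := by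
    intro r
    have h1 : Measurable fun y => f (x + P (w + r • v) + y) := hf.comp (by fun_prop)
    rw [gaussianLaw_eq_map_prod hR htr hP hPR he1, ← hR', integral_map (by fun_prop)
      h1.aestronglyMeasurable, integral_prod_symm]
    · refine integral_congr_ae (Eventually.of_forall fun ξ => ?_)
      refine integral_congr_ae (Eventually.of_forall fun y => ?_)
      show f _ = f _
      congr 1
      rw [map_add, map_smul]
      nth_rewrite 1 [hv']
      rw [map_smul]
      module
    · exact integrable_of_bounded (h1.comp (by fun_prop)) fun p => hM _
  refine ⟨‖v‖ * c, ?_, fun r hr => ?_⟩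
  · rw [abs_mul, abs_norm, mul_comm]
    exact mul_le_mul_of_nonneg_right hc hv0.le
  · have h0 := hF 0
    simp only [zero_smul, add_zero, zero_mul] at h0
    rw [hF r, h0]
    have := hT (r * ‖v‖) (by rwa [abs_mul, abs_norm])
    rw [mul_pow, mul_assoc] at this
    exact this

variable {T : C0Semigroup H} {Q : H →L[ℝ] H}

/-- The smoothing property of the Ornstein–Uhlenbeck semigroup. -/
theorem exists_hasFDerivAt_ouSemigroup (hQ : Q.IsPositive) {t : ℝ}
    (htr : IsTraceClass (covOp T Q t)) (hr : range (T.op t) ⊆ range (posSqrt (covOp T Q t)))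
    {f : H → ℝ} (hf : Measurable f) {M : ℝ} (hM : ∀ y, |f y| ≤ M) (x : H) :
    ∃ L : H →L[ℝ] ℝ, ‖L‖ ≤ M * ‖lambdaOp T Q t hr‖ ∧ HasFDerivAt (ouSemigroup T Q t f) L x := by
  have hM0 : 0 ≤ M := (abs_nonneg _).trans (hM 0)
  have hR := covOp_isPositive T hQ t
  obtain ⟨hP, hPR⟩ := posSqrt_spec hR
  obtain ⟨L, hL, hd⟩ := exists_hasFDerivAt_integral_gaussianLaw hR htr hP hPR hf hM 0
    (lambdaOp T Q t hr x)
  refine ⟨L.comp (lambdaOp T Q t hr), (L.opNorm_comp_le _).trans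
    (mul_le_mul_of_nonneg_right hL (norm_nonneg _)), ?_⟩
  -- Chain rule for S_t f = Φ ∘ Λ(t); the factor ‖Λ(t)‖ enters here.
  have h := hd.comp x (lambdaOp T Q t hr).hasFDerivAt
  refine h.congr_of_eventuallyEq (Eventually.of_forall fun z => ?_)
  have hz : posSqrt (covOp T Q t) (lambdaOp T Q t hr z) = T.op t z := apply_invComp _ _ hr z
  simp only [ouSemigroup, Function.comp, zero_add, hz]

end Kolmogorov

namespace Kolmogorov

/-! ### Measurability of families of measures with continuous characteristic functions -/

/-- A weakly continuous family of probability measures is a measurable family. -/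
theorem measurable_of_continuous_probabilityMeasure {α Ω : Type*} [TopologicalSpace α]
    [MeasurableSpace α] [OpensMeasurableSpace α] [TopologicalSpace Ω] [MeasurableSpace Ω]
    [BorelSpace Ω] [HasOuterApproxClosed Ω] {μ : α → ProbabilityMeasure Ω} (hμ : Continuous μ) :
    Measurable fun a => (μ a : Measure Ω) := by
  -- Closed sets form a generating π-system, and their indicators are limits of bounded continuous
  -- functions, whose integrals are continuous in the parameter.
  refine Measurable.measure_of_isPiSystem_of_isProbabilityMeasure
    (BorelSpace.measurable_eq.trans borel_eq_generateFrom_isClosed) isPiSystem_isClosed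
    fun F hF => ?_
  have hF' : IsClosed F := hF
  refine measurable_of_tendsto_metrizable (f := fun n a => ∫⁻ x, hF'.apprSeq n x ∂(μ a : Measure Ω))
    (fun n => Continuous.measurable ?_) ?_
  · rw [continuous_iff_continuousAt]
    intro a
    exact ProbabilityMeasure.tendsto_iff_forall_lintegral_tendsto.1 (hμ.tendsto a) _
  · rw [tendsto_pi_nhds]
    intro a
    exact HasOuterApproxClosed.tendsto_lintegral_apprSeq hF' _

/-- Lévy's continuity theorem gives weak continuity along sequences, which suffices on a first
countable parameter space. -/
theorem measurable_of_continuous_charFun_finiteDimensional {α E : Type*} [TopologicalSpace α]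
    [FirstCountableTopology α] [MeasurableSpace α] [OpensMeasurableSpace α]
    [NormedAddCommGroup E] [InnerProductSpace ℝ E] [FiniteDimensional ℝ E] [MeasurableSpace E]
    [BorelSpace E] {μ : α → Measure E} [hp : ∀ a, IsProbabilityMeasure (μ a)]
    (h : ∀ y, Continuous fun a => charFun (μ a) y) : Measurable μ := by
  let ν : α → ProbabilityMeasure E := fun a => ⟨μ a, hp a⟩
  have hc : Continuous ν := by
    refine continuous_iff_seqContinuous.2 fun u a hu => ?_
    exact ProbabilityMeasure.tendsto_of_tendsto_charFun fun y => ((h y).tendsto a).comp hu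
  exact measurable_of_continuous_probabilityMeasure hc

/-- A family of probability measures on a separable Hilbert space is measurable if the
characteristic functions depend continuously on the parameter. -/
theorem measurable_of_continuous_charFun {α H : Type*} [TopologicalSpace α]
    [FirstCountableTopology α] [MeasurableSpace α] [OpensMeasurableSpace α]
    [NormedAddCommGroup H] [InnerProductSpace ℝ H] [CompleteSpace H] [SecondCountableTopology H]
    [MeasurableSpace H] [BorelSpace H] {μ : α → Measure H} [∀ a, IsProbabilityMeasure (μ a)]
    (h : ∀ y, Continuous fun a => charFun (μ a) y) : Measurable μ := by
  let J : H → H → ℝ := fun y d => ⟪d, y⟫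
  have hJ : Measurable J := measurable_pi_lambda _ fun d => by fun_prop
  -- The Borel σ-algebra is generated by inner products: the identity is weakly measurable for the
  -- smaller σ-algebra, hence strongly so by separability. Measurability may thus be tested on the
  -- images in ℝ^H.
  have hcomap : MeasurableSpace.comap J inferInstance = (inferInstance : MeasurableSpace H) := by
    refine le_antisymm hJ.comap_le ?_
    have h1 : @StronglyMeasurable H H _ (MeasurableSpace.comap J inferInstance) id := by
      refine @stronglyMeasurable_of_inner H _ _ _ _ H (MeasurableSpace.comap J inferInstance) id
        fun d => ?_
      exact (measurable_pi_apply d).comp (comap_measurable J)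
    have h2 := h1.measurable.comap_le
    simpa using h2
  have hp : ∀ a, IsProbabilityMeasure ((μ a).map J) := fun a =>
    Measure.isProbabilityMeasure_map hJ.aemeasurable
  have hmap : Measurable fun a => (μ a).map J := by
    refine Measurable.measure_of_isPiSystem_of_isProbabilityMeasure
      generateFrom_measurableCylinders.symm isPiSystem_measurableCylinders fun s hs => ?_
    obtain ⟨I, S, hS, rfl⟩ := (mem_measurableCylinders s).1 hs
    -- A cylinder depends on finitely many inner products. The characteristic function of this
    -- marginal at y is that of `μ a` at ∑ y_d d.
    let G : H → EuclideanSpace ℝ I := fun y => WithLp.toLp 2 (fun d : I => ⟪(d : H), y⟫)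
    have hG : Measurable G := by
      refine (WithLp.measurable_toLp 2 _).comp (measurable_pi_lambda _ fun d => by fun_prop)
    have hGp : ∀ a, IsProbabilityMeasure ((μ a).map G) := fun a =>
      Measure.isProbabilityMeasure_map hG.aemeasurable
    have hGm : Measurable fun a => (μ a).map G := by
      refine measurable_of_continuous_charFun_finiteDimensional fun y => ?_
      convert! h (∑ d : I, y d • (d : H)) using 2 with a
      rw [charFun_apply, charFun_apply, integral_map hG.aemeasurable (by fun_prop)]
      refine integral_congr_ae (Eventually.of_forall fun z => ?_)
      simp [G, PiLp.inner_apply, inner_sum, real_inner_smul_right, real_inner_comm]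
    have hS' : MeasurableSet ((fun z : EuclideanSpace ℝ I => (z : I → ℝ)) ⁻¹' S) :=
      (by fun_prop : Measurable fun z : EuclideanSpace ℝ I => (z : I → ℝ)) hS
    have := (Measure.measurable_coe hS').comp hGm
    convert! this using 2 with a
    rw [Function.comp, Measure.map_apply hJ hS.cylinder, Measure.map_apply hG hS']
    rfl
  refine Measure.measurable_of_measurable_coe _ fun s hs => ?_
  replace hs : MeasurableSet[MeasurableSpace.comap J inferInstance] s := by rwa [hcomap]
  obtain ⟨S, hS, rfl⟩ := hs
  have := (Measure.measurable_coe hS).comp hmap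
  convert! this using 2 with a
  exact (Measure.map_apply hJ hS).symm

/-! ### Measurability of the Ornstein–Uhlenbeck semigroup -/

variable {H : Type*} [NormedAddCommGroup H] [InnerProductSpace ℝ H]

/-- Separate continuity in time and space gives joint measurability. The cut-off at 0 is there
because `T.op` is unconstrained at negative times. -/
theorem C0Semigroup.measurable_op [MeasurableSpace H] [BorelSpace H] [SecondCountableTopology H]
    (T : C0Semigroup H) : Measurable fun p : ℝ × H => T.op (max p.1 0) p.2 := by
  have h : StronglyMeasurable (Function.uncurry fun (x : H) (t : ℝ) => T.op (max t 0) x) :=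
    stronglyMeasurable_uncurry_of_continuous_of_stronglyMeasurable
      (fun t => (T.op (max t 0)).continuous) fun x => by
        have : Continuous fun t : ℝ => T.op (max t 0) x :=
          (T.continuousOn x).comp_continuous (by fun_prop) fun t => le_max_right t 0
        exact this.stronglyMeasurable
  exact h.measurable.comp measurable_swap

variable [CompleteSpace H] [SecondCountableTopology H]

theorem covOp_of_nonpos (T : C0Semigroup H) (Q : H →L[ℝ] H) {t : ℝ} (ht : t ≤ 0) :
    covOp T Q t = 0 := by
  ext x
  show ∫ s in Ioc 0 t, T.op s (Q (ContinuousLinearMap.adjoint (T.op s) x)) = 0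
  rw [Ioc_eq_empty (not_lt.2 ht)]
  simp

/-- A primitive of a locally integrable function, extended by zero to s ≤ 0 to match the vanishing
of `covOp` there. -/
theorem continuous_inner_covOp (T : C0Semigroup H) (Q : H →L[ℝ] H) (y : H) :
    Continuous fun t => ⟪covOp T Q t y, y⟫ := by
  set g : ℝ → ℝ := (Ioi 0).indicator fun s => ⟪y, covIntegrand T Q y s⟫
  have hpos : ∀ s, 0 < s → g s = ⟪y, covIntegrand T Q y s⟫ := fun s hs =>
    indicator_of_mem (mem_Ioi.2 hs) _
  have hneg : ∀ s, s ≤ 0 → g s = 0 := fun s hs => indicator_of_notMem (not_lt.2 hs) _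
  have hg : ∀ b, IntegrableOn g (Ioc 0 b) := fun b => by
    have h : IntegrableOn (fun s => ⟪y, covIntegrand T Q y s⟫) (Ioc 0 b) :=
      (integrableOn_covIntegrand T Q b y).const_inner (𝕜 := ℝ) y
    exact h.congr_fun (fun s hs => (hpos s hs.1).symm) measurableSet_Ioc
  have hg0 : ∀ a, IntegrableOn g (Iic a ∩ Iic 0) := fun a => by
    refine (integrableOn_zero (μ := volume)).congr_fun (fun s hs => ?_)
      (measurableSet_Iic.inter measurableSet_Iic)
    exact (hneg s hs.2).symm
  have hgi : ∀ a b, IntervalIntegrable g volume a b := fun a b => by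
    refine (intervalIntegrable_iff.2 ?_)
    refine ((hg (max a b)).union (hg0 (max a b))).mono_set fun s hs => ?_
    rcases le_or_gt s 0 with h | h
    · exact Or.inr ⟨hs.2, h⟩
    · exact Or.inl ⟨h, hs.2⟩
  have h := intervalIntegral.continuous_primitive hgi 0
  convert! h using 2 with t
  rcases le_or_gt t 0 with ht | ht
  · rw [covOp_of_nonpos T Q ht, intervalIntegral.integral_of_ge ht,
      setIntegral_congr_fun (f := g) (g := fun _ => (0 : ℝ)) measurableSet_Ioc
        fun s hs => hneg s hs.2]
    simp
  · rw [intervalIntegral.integral_of_le ht.le, real_inner_comm,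
      setIntegral_congr_fun (f := g) (g := fun s => ⟪y, covIntegrand T Q y s⟫) measurableSet_Ioc
        fun s hs => hpos s hs.1]
    exact (integral_inner (integrableOn_covIntegrand T Q t y) y).symm

variable [MeasurableSpace H] [BorelSpace H] {T : C0Semigroup H} {Q : H →L[ℝ] H}

theorem gaussianLaw_covOp_spec (hQ : Q.IsPositive)
    (hQt : ∀ t : ℝ, 0 < t → IsTraceClass (covOp T Q t)) (t : ℝ) :
    IsProbabilityMeasure (gaussianLaw (covOp T Q t)) ∧ ∀ y : H,
      charFun (gaussianLaw (covOp T Q t)) y =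
        Complex.exp (-((⟪covOp T Q t y, y⟫ / 2 : ℝ) : ℂ)) := by
  refine gaussianLaw_spec (covOp_isPositive T hQ t) ?_
  rcases le_or_gt t 0 with ht | ht
  · rw [covOp_of_nonpos T Q ht]
    exact isTraceClass_zero
  · exact hQt t ht

/-- Makes t ↦ N_{Q_t} a kernel, so that S_{t-s} can be integrated in s. -/
theorem measurable_gaussianLaw_covOp (hQ : Q.IsPositive)
    (hQt : ∀ t : ℝ, 0 < t → IsTraceClass (covOp T Q t)) :
    Measurable fun t => gaussianLaw (covOp T Q t) := by
  have : ∀ t, IsProbabilityMeasure (gaussianLaw (covOp T Q t)) := fun t =>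
    (gaussianLaw_covOp_spec hQ hQt t).1
  refine measurable_of_continuous_charFun fun y => ?_
  simp_rw [fun t => (gaussianLaw_covOp_spec hQ hQt t).2 y]
  have := continuous_inner_covOp T Q y
  fun_prop

/-- Joint measurability of `S_r f_a (x)` in `(r, x, a)`, for `r ≥ 0`. -/
theorem measurable_ouSemigroup {α : Type*} [MeasurableSpace α] (hQ : Q.IsPositive)
    (hQt : ∀ t : ℝ, 0 < t → IsTraceClass (covOp T Q t)) {f : α → H → ℝ}
    (hf : Measurable (Function.uncurry f)) :
    ∃ g : ℝ × H × α → ℝ, Measurable g ∧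
      ∀ r x a, 0 ≤ r → g (r, x, a) = ouSemigroup T Q r (f a) x := by
  let κ : Kernel ℝ H := ⟨fun t => gaussianLaw (covOp T Q t), measurable_gaussianLaw_covOp hQ hQt⟩
  have hκ : IsMarkovKernel κ := ⟨fun t => (gaussianLaw_covOp_spec hQ hQt t).1⟩
  let κ' : Kernel (ℝ × H × α) H := κ.comap Prod.fst measurable_fst
  refine ⟨fun p => ∫ y, f p.2.2 (T.op (max p.1 0) p.2.1 + y) ∂κ' p, ?_, fun r x a hr => ?_⟩
  · have h1 : Measurable fun q : (ℝ × H × α) × H => T.op (max q.1.1 0) q.1.2.1 :=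
      T.measurable_op.comp (by fun_prop : Measurable fun q : (ℝ × H × α) × H => (q.1.1, q.1.2.1))
    have h2 : Measurable fun q : (ℝ × H × α) × H =>
        f q.1.2.2 (T.op (max q.1.1 0) q.1.2.1 + q.2) :=
      hf.comp ((by fun_prop : Measurable fun q : (ℝ × H × α) × H => q.1.2.2).prodMk
        (h1.add measurable_snd))
    exact (h2.stronglyMeasurable.integral_kernel_prod_right' (κ := κ')).measurable
  · show ∫ y, f a (T.op (max r 0) x + y) ∂gaussianLaw (covOp T Q r) = _
    rw [max_eq_left hr]
    rfl

theorem abs_ouSemigroup_le (hQ : Q.IsPositive)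
    (hQt : ∀ t : ℝ, 0 < t → IsTraceClass (covOp T Q t)) {f : H → ℝ} {M : ℝ}
    (hM : ∀ y, |f y| ≤ M) (t : ℝ) (x : H) : |ouSemigroup T Q t f x| ≤ M := by
  have := (gaussianLaw_covOp_spec hQ hQt t).1
  exact abs_integral_le_of_bounded fun y => hM _

end Kolmogorov

namespace Kolmogorov

/-! ### The Beta integral over `(0, t)` -/

theorem integral_rpow_mul_sub_rpow {a b t : ℝ} (ha : 0 < a) (hb : 0 < b) (ht : 0 < t) :
    ∫ s in (0 : ℝ)..t, s ^ (a - 1) * (t - s) ^ (b - 1) =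
      t ^ (a + b - 1) * (Real.Gamma a * Real.Gamma b / Real.Gamma (a + b)) := by
  have h := Complex.betaIntegral_scaled a b ht
  rw [Complex.betaIntegral_eq_Gamma_mul_div a b (by simpa) (by simpa)] at h
  have h1 : ∫ s in (0 : ℝ)..t, (s : ℂ) ^ ((a : ℂ) - 1) * ((t : ℂ) - s) ^ ((b : ℂ) - 1) =
      ∫ s in (0 : ℝ)..t, ((s ^ (a - 1) * (t - s) ^ (b - 1) : ℝ) : ℂ) := by
    refine intervalIntegral.integral_congr fun s hs => ?_
    rw [uIcc_of_le ht.le] at hs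
    push_cast [Complex.ofReal_cpow hs.1, Complex.ofReal_cpow (sub_nonneg.2 hs.2)]
    rfl
  rw [h1, intervalIntegral.integral_ofReal, ← Complex.ofReal_add, Complex.Gamma_ofReal,
    Complex.Gamma_ofReal, Complex.Gamma_ofReal, ← Complex.ofReal_one, ← Complex.ofReal_sub,
    ← Complex.ofReal_cpow ht.le] at h
  exact_mod_cast h

/-- A non-integrable function has integral 0 by convention, whereas the Beta value is positive. -/
theorem intervalIntegrable_rpow_mul_sub_rpow {a b t : ℝ} (ha : 0 < a) (hb : 0 < b) (ht : 0 < t) :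
    IntervalIntegrable (fun s : ℝ => s ^ (a - 1) * (t - s) ^ (b - 1)) volume 0 t := by
  refine intervalIntegral.intervalIntegrable_of_integral_ne_zero ?_
  rw [integral_rpow_mul_sub_rpow ha hb ht]
  have := Real.Gamma_pos_of_pos ha
  have := Real.Gamma_pos_of_pos hb
  have := Real.Gamma_pos_of_pos (add_pos ha hb)
  positivity

/-! ### Gradients depending measurably on a parameter -/

variable {H : Type*} [NormedAddCommGroup H] [InnerProductSpace ℝ H] [CompleteSpace H]

theorem norm_gradient (f : H → ℝ) (x : H) : ‖gradient f x‖ = ‖fderiv ℝ f x‖ := by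
  simp [gradient]

variable [SecondCountableTopology H] [MeasurableSpace H] [BorelSpace H]

/-- Each component of the gradient is a limit of jointly measurable difference quotients, and
separability upgrades weak to strong measurability. The indicator discards parameters where
differentiability is not known. -/
theorem stronglyMeasurable_indicator_gradient {α : Type*} [MeasurableSpace α] {W : α → H → ℝ}
    (hW : Measurable (Function.uncurry W)) {S : Set α} (hS : MeasurableSet S)
    (hd : ∀ a ∈ S, Differentiable ℝ (W a)) :
    StronglyMeasurable fun p : α × H =>
      (Prod.fst ⁻¹' S).indicator (fun p : α × H => gradient (W p.1) p.2) p := by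
  refine stronglyMeasurable_of_inner fun v => ?_
  refine measurable_of_tendsto_metrizable (f := fun (n : ℕ) (p : α × H) =>
    (Prod.fst ⁻¹' S).indicator (fun p : α × H =>
      ((n : ℝ) + 1) * (W p.1 (p.2 + ((n : ℝ) + 1)⁻¹ • v) - W p.1 p.2)) p) (fun n => ?_) ?_
  · have h1 : Measurable fun p : α × H => W p.1 (p.2 + ((n : ℝ) + 1)⁻¹ • v) :=
      hW.comp (by fun_prop : Measurable fun p : α × H => (p.1, p.2 + ((n : ℝ) + 1)⁻¹ • v))
    have h2 : Measurable fun p : α × H => W p.1 p.2 := hW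
    exact ((h1.sub h2).const_mul _).indicator (measurable_fst hS)
  · rw [tendsto_pi_nhds]
    rintro ⟨a, x⟩
    by_cases ha : a ∈ S
    · have hmem : (a, x) ∈ (Prod.fst ⁻¹' S : Set (α × H)) := ha
      simp only [indicator_of_mem hmem]
      have hc : Tendsto (fun n : ℕ => ‖(n : ℝ) + 1‖) atTop atTop :=
        tendsto_norm_atTop_atTop.comp
          (tendsto_atTop_add_const_right _ _ tendsto_natCast_atTop_atTop)
      have h := (hd a ha x).hasFDerivAt.lim v hc
      have h2 : ⟪v, gradient (W a) x⟫ = fderiv ℝ (W a) x v := by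
        rw [real_inner_comm, gradient, InnerProductSpace.toDual_symm_apply]
      rw [h2]
      exact h
    · have hmem : (a, x) ∉ (Prod.fst ⁻¹' S : Set (α × H)) := ha
      simp only [indicator_of_notMem hmem, inner_zero_right]
      exact tendsto_const_nhds

/-! ### Time integrals of the Ornstein–Uhlenbeck semigroup -/

variable {T : C0Semigroup H} {Q : H →L[ℝ] H}

/-- The smoothing estimate `‖D S_t f‖_∞ ≤ C t^{-δ} ‖f‖_∞`. -/
def GradientEstimate (T : C0Semigroup H) (Q : H →L[ℝ] H) (C δ : ℝ) : Prop :=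
  ∀ t : ℝ, 0 < t → ∀ f : H → ℝ, Measurable f → ∀ M : ℝ, (∀ y, |f y| ≤ M) → ∀ x : H,
    DifferentiableAt ℝ (ouSemigroup T Q t f) x ∧
      ‖gradient (ouSemigroup T Q t f) x‖ ≤ M * (C * t ^ (-δ))

theorem gradientEstimate_of_norm_lambdaOp_le (hQ : Q.IsPositive)
    (hQt : ∀ t : ℝ, 0 < t → IsTraceClass (covOp T Q t))
    (hrange : ∀ t : ℝ, 0 < t → range (T.op t) ⊆ range (posSqrt (covOp T Q t))) {C δ : ℝ}
    (hΛ : ∀ (t : ℝ) (ht : 0 < t), ‖lambdaOp T Q t (hrange t ht)‖ ≤ C / t ^ δ) :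
    GradientEstimate T Q C δ := by
  intro t ht f hf M hM x
  obtain ⟨L, hL, hd⟩ := exists_hasFDerivAt_ouSemigroup hQ (hQt t ht) (hrange t ht) hf hM x
  refine ⟨hd.differentiableAt, ?_⟩
  rw [norm_gradient, hd.fderiv, Real.rpow_neg ht.le, ← div_eq_mul_inv]
  exact hL.trans (mul_le_mul_of_nonneg_left (hΛ t ht) ((abs_nonneg _).trans (hM 0)))

variable {K : ℝ → H → ℝ} {β a : ℝ}

theorem intervalIntegrable_ouSemigroup (hQ : Q.IsPositive)
    (hQt : ∀ t : ℝ, 0 < t → IsTraceClass (covOp T Q t)) (hK : Measurable (Function.uncurry K))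
    (ha : 0 < a) (hKb : ∀ s, 0 < s → ∀ y, |K s y| ≤ β * s ^ (a - 1)) {t : ℝ} (ht : 0 < t) (x : H) :
    IntervalIntegrable (fun s => ouSemigroup T Q (t - s) (K s) x) volume 0 t := by
  obtain ⟨g, hg, hgS⟩ := measurable_ouSemigroup hQ hQt hK
  have hb : IntervalIntegrable (fun s : ℝ => β * s ^ (a - 1)) volume 0 t :=
    (intervalIntegral.intervalIntegrable_rpow' (by linarith)).const_mul β
  rw [intervalIntegrable_iff_integrableOn_Ioc_of_le ht.le] at hb ⊢
  have hm : Measurable fun s : ℝ => g (t - s, x, s) := hg.comp (by fun_prop)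
  refine Integrable.mono' hb (hm.aestronglyMeasurable.congr ?_) ?_
  · filter_upwards [ae_restrict_mem measurableSet_Ioc] with s hs
    exact hgS _ _ _ (sub_nonneg.2 hs.2)
  · filter_upwards [ae_restrict_mem measurableSet_Ioc] with s hs
    exact abs_ouSemigroup_le hQ hQt (hKb s hs.1) _ _

theorem abs_integral_ouSemigroup_le (hQ : Q.IsPositive)
    (hQt : ∀ t : ℝ, 0 < t → IsTraceClass (covOp T Q t))
    (ha : 0 < a) (hKb : ∀ s, 0 < s → ∀ y, |K s y| ≤ β * s ^ (a - 1)) {t : ℝ} (ht : 0 < t) (x : H) :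
    |∫ s in (0 : ℝ)..t, ouSemigroup T Q (t - s) (K s) x| ≤ β * (t ^ a / a) := by
  have hb : IntervalIntegrable (fun s : ℝ => β * s ^ (a - 1)) volume 0 t :=
    (intervalIntegral.intervalIntegrable_rpow' (by linarith)).const_mul β
  have h := intervalIntegral.norm_integral_le_of_norm_le (μ := volume) ht.le
    (f := fun s => ouSemigroup T Q (t - s) (K s) x) (g := fun s => β * s ^ (a - 1))
    (Eventually.of_forall fun s hs => abs_ouSemigroup_le hQ hQt (hKb s hs.1) _ _) hb
  rw [intervalIntegral.integral_const_mul, integral_rpow (Or.inl (by linarith))] at h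
  simpa [Real.zero_rpow ha.ne'] using h

/-- Differentiation under the integral sign, dominated by β C s^{a-1} (t-s)^{-δ}. Both endpoint
singularities are integrable because a > 0 and δ < 1, and the dominating integral is the Beta value.
-/
theorem differentiableAt_integral_ouSemigroup (hQ : Q.IsPositive)
    (hQt : ∀ t : ℝ, 0 < t → IsTraceClass (covOp T Q t)) {C δ : ℝ} (hδ : δ < 1)
    (hest : GradientEstimate T Q C δ) (hK : Measurable (Function.uncurry K))
    (ha : 0 < a) (hKb : ∀ s, 0 < s → ∀ y, |K s y| ≤ β * s ^ (a - 1)) {t : ℝ} (ht : 0 < t) (x : H) :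
    DifferentiableAt ℝ (fun x => ∫ s in (0 : ℝ)..t, ouSemigroup T Q (t - s) (K s) x) x ∧
      ‖gradient (fun x => ∫ s in (0 : ℝ)..t, ouSemigroup T Q (t - s) (K s) x) x‖ ≤
        β * C * (t ^ (a - δ) * (Real.Gamma a * Real.Gamma (1 - δ) / Real.Gamma (a + (1 - δ)))) := by
  obtain ⟨g, hg, hgS⟩ := measurable_ouSemigroup hQ hQt hK
  -- The endpoint s = t is removed because smoothing requires t - s > 0.
  let μ : Measure ℝ := volume.restrict (Ioo 0 t)
  let W : ℝ → H → ℝ := fun s x => g (t - s, x, s)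
  have hWm : Measurable (Function.uncurry W) :=
    hg.comp (by fun_prop : Measurable fun p : ℝ × H => (t - p.1, p.2, p.1))
  have hWS : ∀ s ∈ Ioo 0 t, W s = ouSemigroup T Q (t - s) (K s) := fun s hs =>
    funext fun x => hgS _ _ _ (sub_nonneg.2 hs.2.le)
  have hKm : ∀ s, Measurable (K s) := fun s => hK.comp measurable_prodMk_left
  let bound : ℝ → ℝ := fun s => β * C * (s ^ (a - 1) * (t - s) ^ (1 - δ - 1))
  have hdW : ∀ s ∈ Ioo 0 t, ∀ x, DifferentiableAt ℝ (W s) x ∧ ‖fderiv ℝ (W s) x‖ ≤ bound s := by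
    intro s hs x
    obtain ⟨h1, h2⟩ := hest (t - s) (sub_pos.2 hs.2) (K s) (hKm s) _ (hKb s hs.1) x
    rw [← norm_gradient, hWS s hs]
    refine ⟨h1, h2.trans (le_of_eq ?_)⟩
    simp only [bound]
    rw [show 1 - δ - 1 = -δ by ring]
    ring
  have hmem : ∀ᵐ s ∂μ, s ∈ Ioo 0 t := ae_restrict_mem measurableSet_Ioo
  have hbi := intervalIntegrable_rpow_mul_sub_rpow ha (sub_pos.2 hδ) ht
  have hbound : Integrable bound μ := by
    have := hbi.const_mul (β * C)
    rwa [intervalIntegrable_iff_integrableOn_Ioo_of_le ht.le] at this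
  have hWx : ∀ x, Measurable fun s => W s x := fun x => hWm.comp measurable_prodMk_right
  have hint : ∀ x, ∫ s in (0 : ℝ)..t, ouSemigroup T Q (t - s) (K s) x = ∫ s, W s x ∂μ := by
    intro x
    rw [intervalIntegral.integral_of_le ht.le, integral_Ioc_eq_integral_Ioo]
    exact setIntegral_congr_fun measurableSet_Ioo fun s hs => (congrFun (hWS s hs) x).symm
  have hWint : Integrable (fun s => W s x) μ := by
    have := intervalIntegrable_ouSemigroup hQ hQt hK ha hKb ht x
    rw [intervalIntegrable_iff_integrableOn_Ioo_of_le ht.le] at this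
    exact this.congr_fun (fun s hs => (congrFun (hWS s hs) x).symm) measurableSet_Ioo
  have hgm : AEStronglyMeasurable (fun s => fderiv ℝ (W s) x) μ := by
    have h1 := stronglyMeasurable_indicator_gradient hWm measurableSet_Ioo
      fun s hs x => (hdW s hs x).1
    have h2 := h1.comp_measurable (measurable_prodMk_right (y := x))
    have h3 := (InnerProductSpace.toDual ℝ H).continuous.comp_stronglyMeasurable h2
    refine h3.aestronglyMeasurable.congr ?_
    filter_upwards [hmem] with s hs
    have hs' : (s, x) ∈ (Prod.fst ⁻¹' Ioo 0 t : Set (ℝ × H)) := hs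
    simp [Function.comp, indicator_of_mem hs', gradient]
  obtain ⟨hFi, hF⟩ := hasFDerivAt_integral_of_dominated_loc_of_lip' (𝕜 := ℝ) (μ := μ)
    (F := fun x s => W s x) (x₀ := x) (s := univ) (bound := bound)
    (F' := fun s => fderiv ℝ (W s) x) univ_mem
    (fun x _ => (hWx x).aestronglyMeasurable) hWint hgm
    (by
      filter_upwards [hmem] with s hs z _
      exact convex_univ.norm_image_sub_le_of_norm_fderiv_le (𝕜 := ℝ)
        (fun x _ => (hdW s hs x).1) (fun x _ => (hdW s hs x).2) (mem_univ _) (mem_univ _))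
    hbound (by filter_upwards [hmem] with s hs using (hdW s hs x).1.hasFDerivAt)
  simp_rw [hint]
  refine ⟨hF.differentiableAt, ?_⟩
  rw [norm_gradient, hF.fderiv]
  refine (norm_integral_le_of_norm_le hbound ?_).trans (le_of_eq ?_)
  · filter_upwards [hmem] with s hs using (hdW s hs x).2
  · have h := integral_rpow_mul_sub_rpow ha (sub_pos.2 hδ) ht
    rw [intervalIntegral.integral_of_le ht.le, integral_Ioc_eq_integral_Ioo] at h
    rw [integral_const_mul, h, show a + (1 - δ) - 1 = a - δ by ring]

theorem exists_measurable_integral_ouSemigroup (hQ : Q.IsPositive)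
    (hQt : ∀ t : ℝ, 0 < t → IsTraceClass (covOp T Q t)) (hK : Measurable (Function.uncurry K)) :
    ∃ W : ℝ → H → ℝ, Measurable (Function.uncurry W) ∧ ∀ t, 0 < t → ∀ x,
      W t x = ∫ s in (0 : ℝ)..t, ouSemigroup T Q (t - s) (K s) x := by
  obtain ⟨g, hg, hgS⟩ := measurable_ouSemigroup hQ hQt hK
  -- Encoding 0 < s ≤ t as an indicator fixes the domain of integration, so measurability of
  -- parameter integrals applies.
  let F : ℝ × H → ℝ → ℝ := fun p s =>
    {q : (ℝ × H) × ℝ | 0 < q.2 ∧ q.2 ≤ q.1.1}.indicator (fun q => g (q.1.1 - q.2, q.1.2, q.2)) (p, s)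
  have hF : Measurable (Function.uncurry F) := by
    have h1 : Measurable fun q : (ℝ × H) × ℝ => g (q.1.1 - q.2, q.1.2, q.2) :=
      hg.comp (by fun_prop)
    have h2 : MeasurableSet {q : (ℝ × H) × ℝ | 0 < q.2} :=
      measurableSet_lt measurable_const measurable_snd
    have h3 : MeasurableSet {q : (ℝ × H) × ℝ | q.2 ≤ q.1.1} :=
      measurableSet_le measurable_snd (measurable_fst.comp measurable_fst)
    exact h1.indicator (h2.inter h3)
  refine ⟨fun t x => ∫ s, F (t, x) s, ?_, fun t ht x => ?_⟩
  · exact (hF.stronglyMeasurable.integral_prod_right (ν := volume)).measurable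
  · rw [intervalIntegral.integral_of_le ht.le, ← integral_indicator measurableSet_Ioc]
    refine integral_congr_ae (Eventually.of_forall fun s => ?_)
    by_cases hs : s ∈ Ioc 0 t
    · have hs' : ((t, x), s) ∈ {q : (ℝ × H) × ℝ | 0 < q.2 ∧ q.2 ≤ q.1.1} := hs
      simp only [F, indicator_of_mem hs, indicator_of_mem hs']
      exact hgS _ _ _ (sub_nonneg.2 hs.2)
    · have hs' : ((t, x), s) ∉ {q : (ℝ × H) × ℝ | 0 < q.2 ∧ q.2 ≤ q.1.1} := hs
      simp only [F, indicator_of_notMem hs, indicator_of_notMem hs']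

/-! ### The supremum norm -/

theorem le_supNorm {X E : Type*} [Norm E] {f : X → E} (hf : IsBoundedFun f) (x : X) :
    ‖f x‖ ≤ supNorm f := by
  obtain ⟨C, hC⟩ := hf
  exact le_ciSup (f := fun x => ‖f x‖) ⟨C, by rintro _ ⟨x, rfl⟩; exact hC x⟩ x

/-! ### Induction over the iterates -/

/-- The first right-hand side, `‖u₀‖ ‖B‖ⁿ Cⁿ t^{n(1-δ)} Γ(1-δ)ⁿ / Γ(1+n(1-δ))`. -/
noncomputable def valueBound (U b C δ : ℝ) (n : ℕ) (t : ℝ) : ℝ :=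
  U * b ^ n * C ^ n * t ^ ((n : ℝ) * (1 - δ)) *
    (Real.Gamma (1 - δ) ^ n / Real.Gamma (1 + (n : ℝ) * (1 - δ)))

/-- The second right-hand side,
`‖u₀‖ ‖B‖ⁿ Cⁿ⁺¹ t^{n(1-δ)-δ} Γ(1-δ)ⁿ⁺¹ / Γ((n+1)(1-δ))`. -/
noncomputable def gradientBound (U b C δ : ℝ) (n : ℕ) (t : ℝ) : ℝ :=
  U * b ^ n * C ^ (n + 1) * t ^ ((n : ℝ) * (1 - δ) - δ) *
    (Real.Gamma (1 - δ) ^ (n + 1) / Real.Gamma (((n : ℝ) + 1) * (1 - δ)))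

/-- The part of `‖B‖ gradientBound` that does not depend on time. -/
noncomputable def driftCoeff (U b C δ : ℝ) (n : ℕ) : ℝ :=
  b * (U * b ^ n * C ^ (n + 1) *
    (Real.Gamma (1 - δ) ^ (n + 1) / Real.Gamma (((n : ℝ) + 1) * (1 - δ))))

/-! ### Gamma-function identities behind the induction step -/

section Bounds

variable {U b C δ : ℝ}

theorem mul_gradientBound (n : ℕ) (t : ℝ) : b * gradientBound U b C δ n t =
    driftCoeff U b C δ n * t ^ (((n : ℝ) + 1) * (1 - δ) - 1) := by
  rw [gradientBound, driftCoeff, show ((n : ℝ) + 1) * (1 - δ) - 1 = n * (1 - δ) - δ by ring]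
  ring

/-- The division by a = (n+1)(1-δ) is absorbed by Γ(1+a) = a Γ(a). -/
theorem driftCoeff_mul_value (hδ : δ < 1) (n : ℕ) (t : ℝ) :
    driftCoeff U b C δ n * (t ^ (((n : ℝ) + 1) * (1 - δ)) / (((n : ℝ) + 1) * (1 - δ))) =
      valueBound U b C δ (n + 1) t := by
  have ha : 0 < ((n : ℝ) + 1) * (1 - δ) := mul_pos (by positivity) (by linarith)
  rw [driftCoeff, valueBound]
  push_cast
  rw [add_comm 1 (((n : ℝ) + 1) * (1 - δ)), Real.Gamma_add_one ha.ne']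
  have := (Real.Gamma_pos_of_pos ha).ne'
  have := ha.ne'
  generalize ((n : ℝ) + 1) * (1 - δ) = a at *
  field_simp
  ring

/-- The Γ(a) in the Beta value cancels the denominator of `driftCoeff`, leaving one more factor
Γ(1-δ) over Γ(a + (1-δ)). -/
theorem driftCoeff_mul_gradient (hδ : δ < 1) (n : ℕ) (t : ℝ) :
    driftCoeff U b C δ n * C * (t ^ (((n : ℝ) + 1) * (1 - δ) - δ) *
      (Real.Gamma (((n : ℝ) + 1) * (1 - δ)) * Real.Gamma (1 - δ) /
        Real.Gamma (((n : ℝ) + 1) * (1 - δ) + (1 - δ)))) = gradientBound U b C δ (n + 1) t := by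
  have ha : 0 < ((n : ℝ) + 1) * (1 - δ) := mul_pos (by positivity) (by linarith)
  rw [driftCoeff, gradientBound]
  push_cast
  rw [show ((n : ℝ) + 1 + 1) * (1 - δ) = ((n : ℝ) + 1) * (1 - δ) + (1 - δ) by ring]
  have := (Real.Gamma_pos_of_pos ha).ne'
  have := (Real.Gamma_pos_of_pos (add_pos ha (sub_pos.2 hδ))).ne'
  generalize ((n : ℝ) + 1) * (1 - δ) = a at *
  field_simp
  ring

end Bounds

/-- The properties of the `n`-th iterate that are propagated by the induction. -/
def IterateRegular (v : ℝ → H → ℝ) (U b C δ : ℝ) (n : ℕ) : Prop :=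
  (∃ W : ℝ → H → ℝ, Measurable (Function.uncurry W) ∧ ∀ t, 0 < t → ∀ x, W t x = v t x) ∧
    ∀ t, 0 < t → ∀ x, |v t x| ≤ valueBound U b C δ n t ∧
      DifferentiableAt ℝ (v t) x ∧ ‖gradient (v t) x‖ ≤ gradientBound U b C δ n t

/-- The drift term `⟨B, Dv⟩` of a regular iterate is jointly measurable, with an integrable
singularity at `0`. -/
theorem IterateRegular.exists_drift {v : ℝ → H → ℝ} {U b C δ : ℝ} {n : ℕ}
    (h : IterateRegular v U b C δ n) {B : H → H} (hB : Measurable B) (hBb : ∀ y, ‖B y‖ ≤ b) :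
    ∃ K : ℝ → H → ℝ, Measurable (Function.uncurry K) ∧
      (∀ s, 0 < s → K s = fun y => ⟪B y, gradient (v s) y⟫) ∧
      ∀ s, 0 < s → ∀ y, |K s y| ≤ driftCoeff U b C δ n * s ^ (((n : ℝ) + 1) * (1 - δ) - 1) := by
  obtain ⟨⟨W, hW, hWv⟩, hv⟩ := h
  have hWv' : ∀ s, 0 < s → W s = v s := fun s hs => funext (hWv s hs)
  have hG := stronglyMeasurable_indicator_gradient hW (measurableSet_Ioi (a := (0 : ℝ)))
    fun s hs x => by rw [hWv' s hs]; exact (hv s hs x).2.1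
  -- Regularity is known only for s > 0; the indicator makes the drift jointly measurable on all of
  -- ℝ × H without affecting integrals over (0, t].
  let K : ℝ → H → ℝ := fun s y =>
    ⟪B y, (Prod.fst ⁻¹' Ioi (0 : ℝ)).indicator (fun p : ℝ × H => gradient (W p.1) p.2) (s, y)⟫
  have hK : ∀ s, 0 < s → K s = fun y => ⟪B y, gradient (v s) y⟫ := by
    intro s hs
    funext y
    have hmem : (s, y) ∈ (Prod.fst ⁻¹' Ioi 0 : Set (ℝ × H)) := hs
    simp only [K, indicator_of_mem hmem, hWv' s hs]
  refine ⟨K, (hB.comp measurable_snd).inner hG.measurable, hK, fun s hs y => ?_⟩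
  rw [hK s hs, ← mul_gradientBound]
  exact (abs_real_inner_le_norm _ _).trans (mul_le_mul (hBb y) (hv s hs y).2.2 (norm_nonneg _)
    ((norm_nonneg _).trans (hBb y)))

theorem iterateRegular_iterTerm (hQ : Q.IsPositive)
    (hQt : ∀ t : ℝ, 0 < t → IsTraceClass (covOp T Q t)) {C δ : ℝ} (hδ : δ < 1)
    (hest : GradientEstimate T Q C δ) {u₀ : H → ℝ} (hu₀ : Measurable u₀) {U : ℝ}
    (hU : ∀ y, |u₀ y| ≤ U) {B : H → H} (hB : Measurable B) {b : ℝ} (hBb : ∀ y, ‖B y‖ ≤ b) (n : ℕ) :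
    IterateRegular (iterTerm T Q u₀ B n) U b C δ n := by
  induction n with
  | zero =>
    refine ⟨?_, fun t ht x => ⟨?_, ?_⟩⟩
    · obtain ⟨g, hg, hgS⟩ := measurable_ouSemigroup (α := Unit) (f := fun _ => u₀) hQ hQt
        (hu₀.comp measurable_snd)
      exact ⟨fun t x => g (t, x, ()), hg.comp (by fun_prop : Measurable fun p : ℝ × H =>
        (p.1, p.2, ())), fun t ht x => hgS t x () ht.le⟩
    · refine (abs_ouSemigroup_le hQ hQt hU t x).trans (le_of_eq ?_)
      simp [valueBound]
    · obtain ⟨h1, h2⟩ := hest t ht u₀ hu₀ U hU x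
      refine ⟨h1, h2.trans (le_of_eq ?_)⟩
      -- For n = 0 the Gamma quotient in `gradientBound` is Γ(1-δ)/Γ(1-δ) = 1, so the bound is the
      -- smoothing estimate itself.
      have := (Real.Gamma_pos_of_pos (sub_pos.2 hδ)).ne'
      simp [gradientBound, this, mul_assoc]
  | succ n ih =>
    obtain ⟨K, hK, hKd, hKb⟩ := ih.exists_drift hB hBb
    have ha : 0 < ((n : ℝ) + 1) * (1 - δ) := mul_pos (by positivity) (by linarith)
    have heq : ∀ t, 0 < t → iterTerm T Q u₀ B (n + 1) t = fun x =>
        ∫ s in (0 : ℝ)..t, ouSemigroup T Q (t - s) (K s) x := by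
      intro t ht
      funext x
      rw [iterTerm, intervalIntegral.integral_of_le ht.le, intervalIntegral.integral_of_le ht.le]
      refine setIntegral_congr_fun measurableSet_Ioc fun s hs => ?_
      simp only [hKd s hs.1]
    refine ⟨?_, fun t ht x => ?_⟩
    · obtain ⟨W, hW, hWv⟩ := exists_measurable_integral_ouSemigroup hQ hQt hK
      exact ⟨W, hW, fun t ht x => by rw [hWv t ht x, heq t ht]⟩
    · rw [heq t ht, ← driftCoeff_mul_value hδ, ← driftCoeff_mul_gradient hδ]
      exact ⟨abs_integral_ouSemigroup_le hQ hQt ha hKb ht x,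
        differentiableAt_integral_ouSemigroup hQ hQt hδ hest hK ha hKb ht x⟩

end Kolmogorov
-- The main theorem
theorem mainTheorem1 {H : Type*} [NormedAddCommGroup H] [InnerProductSpace ℝ H] [CompleteSpace H]
    [SecondCountableTopology H] [MeasurableSpace H] [BorelSpace H]
    (A : H →ₗ.[ℝ] H) (T : C0Semigroup H) (hA : IsGenerator A T)
    (Q : H →L[ℝ] H) (hQ : Q.IsPositive) (hQker : Q.ker = ⊥)
    (hQt : ∀ t : ℝ, 0 < t → IsTraceClass (covOp T Q t))
    (hrange : ∀ t : ℝ, 0 < t → range (T.op t) ⊆ range (posSqrt (covOp T Q t)))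
    (δ : ℝ) (hδ0 : 0 < δ) (hδ1 : δ < 1) (C : ℝ) (hC : 0 < C)
    (hΛ : ∀ (t : ℝ) (ht : 0 < t), ‖lambdaOp T Q t (hrange t ht)‖ ≤ C / t ^ δ)
    (u₀ : H → ℝ) (hu₀ : Measurable u₀) (hu₀b : IsBoundedFun u₀)
    (B : H → H) (hB : Measurable B) (hBb : IsBoundedFun B) :
    -- the iteration is well defined, with iterates in `C_b^1(H)` at positive times
    (∀ (n : ℕ) (t : ℝ), 0 < t →
      IsCb1 (iterTerm T Q u₀ B n t) ∧
      Measurable (driftTerm T Q u₀ B n t) ∧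
      IsBoundedFun (driftTerm T Q u₀ B n t) ∧
      ∀ x : H, IntervalIntegrable
        (fun s => ouSemigroup T Q (t - s) (driftTerm T Q u₀ B n s) x) volume 0 t) ∧
    -- the two uniform estimates
    ∀ (n : ℕ) (t : ℝ), 0 < t →
      supNorm (iterTerm T Q u₀ B n t) ≤
        supNorm u₀ * supNorm B ^ n * C ^ n * t ^ ((n : ℝ) * (1 - δ)) *
          (Real.Gamma (1 - δ) ^ n / Real.Gamma (1 + (n : ℝ) * (1 - δ))) ∧
      supNorm (gradient (iterTerm T Q u₀ B n t)) ≤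
        supNorm u₀ * supNorm B ^ n * C ^ (n + 1) * t ^ ((n : ℝ) * (1 - δ) - δ) *
          (Real.Gamma (1 - δ) ^ (n + 1) / Real.Gamma (((n : ℝ) + 1) * (1 - δ))) := by
  have hest := gradientEstimate_of_norm_lambdaOp_le hQ hQt hrange hΛ
  have hreg := fun n => iterateRegular_iterTerm hQ hQt hδ1 hest hu₀ (le_supNorm hu₀b) hB
    (le_supNorm hBb) n
  refine ⟨fun n t ht => ?_, fun n t ht => ⟨?_, ?_⟩⟩
  · obtain ⟨K, hK, hKd, hKb⟩ := (hreg n).exists_drift hB (le_supNorm hBb)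
    have hKd' : ∀ s, 0 < s → K s = driftTerm T Q u₀ B n s := hKd
    refine ⟨⟨fun x => ((hreg n).2 t ht x).2.1, ⟨_, fun x => ((hreg n).2 t ht x).1⟩,
      ⟨_, fun x => ((hreg n).2 t ht x).2.2⟩⟩, ?_, ⟨driftCoeff (supNorm u₀) (supNorm B) C δ n *
        t ^ (((n : ℝ) + 1) * (1 - δ) - 1), fun y => ?_⟩, fun x => ?_⟩
    · rw [← hKd' t ht]
      exact hK.comp measurable_prodMk_left
    · rw [← hKd' t ht]
      exact hKb t ht y
    · have ha : 0 < ((n : ℝ) + 1) * (1 - δ) := mul_pos (by positivity) (by linarith)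
      -- `K` matches the drift only at positive times, which is enough on the half-open interval (0,
      -- t].
      refine (intervalIntegrable_ouSemigroup hQ hQt hK ha hKb ht x).congr fun s hs => ?_
      rw [uIoc_of_le ht.le] at hs
      simp only [hKd' s hs.1]
  · exact ciSup_le fun x => ((hreg n).2 t ht x).1
  · exact ciSup_le fun x => ((hreg n).2 t ht x).2.2
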